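/- Points of space and of images are points of $\mathbb{P}^3=\mathbb{P}^3(\mathbb{C})$ and $\mathbb{P}^2=\mathbb{P}^2(\mathbb{C})$. A camera is a real $3\times 4$ matrix $P$ of rank $3$; its centre is the point of $\mathbb{P}^3$ given by its kernel. A configuration $(P_1,\dots,P_n,X)$ consists of $n$ cameras with pairwise distinct centres and a set $X\subseteq\mathbb{P}^3$. A tuple $s=(s_1,\dots,s_n)\in(\mathbb{P}^2)^n$ is an image of $x\in\mathbb{P}^3$ if $(x,s)$ lies in the closure of the graph of the joint camera map $x\mapsto(P_1x,\dots,P_nx)$, that is, if for every $i$ the vector $P_ix$ is a (possibly zero) multiple of $s_i$. The configuration is a reconstruction of $S\subseteq(\mathbb{P}^2)^n$ if every $s\in S$ is an image of some $x\in X$ and every $x\in X$ has an image in $S$. Two configurations $(P_1,\dots,P_n,X)$ and $(Q_1,\dots,Q_n,Y)$ are equivalent if there is $H\in\mathrm{PGL}(4)$ with $H(X)=Y$ and $P_iH^{-1}=Q_i$ (up to scale) for all $i$, and conjugate if they are nonequivalent reconstructions of the same set. The fundamental matrix $F_P^{ij}$ is the real $3\times3$ matrix, considered up to a nonzero factor,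 of the bilinear form $\mathbf{x}^TF_P^{ij}\mathbf{y}=\det\begin{bmatrix}P_i&\mathbf{x}&0\\P_j&0&\mathbf{y}\end{bmatrix}$. A configuration is (non-trivially) critical if it has a conjugate configuration with $F_P^{ij}\neq F_Q^{ij}$ for all $i\neq j$. **Proposition.** Let $C\subset\mathbb{P}^3$ be an irreducible quartic curve that is the intersection of two real quadrics, i.e. $C=\{q_1=q_2=0\}$ where $q_1,q_2$ are linearly independent real quadratic forms that generate a prime ideal of $\mathbb{C}[x_0,x_1,x_2,x_3]$ (so $C$ is a smooth elliptic quartic, or a singular rational quartic with a node or a cusp). Let $n\ge 2$, and let $(P_1,\dots,P_n,X)$ be a configuration such that all camera centres and all points of $X$ lie on $C$ and no camera centre is a singular point of $C$. Then $(P_1,\dots,P_n,X)$ is a (non-trivial) critical configuration. -/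

import Mathlib

open scoped LinearAlgebra.Projectivization Matrix

namespace Vision

/-- Complex projective 3-space, the space of space points. -/
abbrev Space : Type := ℙ ℂ (Fin 4 → ℂ)

/-- Complex projective plane, the space of image points. -/
abbrev ImagePlane : Type := ℙ ℂ (Fin 3 → ℂ)

/-! ### Cameras -/

/-- A (real projective pinhole) camera: a real `3 × 4` matrix of full rank. -/
structure Camera where
  mat : Matrix (Fin 3) (Fin 4) ℝ
  full_rank : mat.rank = 3

namespace Camera

/-- The camera matrix with its entries regarded as complex numbers. -/
noncomputable def matC (P : Camera) : Matrix (Fin 3) (Fin 4) ℂ :=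
  P.mat.map (algebraMap ℝ ℂ)

theorem finrank_ker (P : Camera) :
    Module.finrank ℂ (LinearMap.ker P.matC.mulVecLin) = 1 := by
  have hs : Function.Surjective P.mat.mulVecLin := by
    rw [← LinearMap.range_eq_top]
    apply Submodule.eq_top_of_finrank_eq
    have h := P.full_rank
    rw [Matrix.rank] at h
    rw [h]
    simp
  choose b hb using fun j : Fin 3 => hs (Pi.single j 1)
  have hB : P.mat * (Matrix.of b)ᵀ = 1 := by
    ext i j
    have := congrFun (hb j) i
    simpa [Matrix.mul_apply, Matrix.mulVec, dotProduct, Matrix.one_apply, Pi.single_apply]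
      using this
  have hBC : P.matC * ((Matrix.of b)ᵀ).map (algebraMap ℝ ℂ) = 1 := by
    rw [matC, ← Matrix.map_mul, hB, Matrix.map_one _ (map_zero _) (map_one _)]
  have hsC : Function.Surjective P.matC.mulVecLin := fun v =>
    ⟨((Matrix.of b)ᵀ).map (algebraMap ℝ ℂ) *ᵥ v, by
      rw [Matrix.mulVecLin_apply, Matrix.mulVec_mulVec, hBC, Matrix.one_mulVec]⟩
  have h := LinearMap.finrank_range_add_finrank_ker P.matC.mulVecLin
  rw [LinearMap.range_eq_top.2 hsC] at h
  simp at h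
  omega

/-- The camera centre: the point of projective space given by the kernel of the camera matrix. -/
noncomputable def center (P : Camera) : Space :=
  Projectivization.mk'' (LinearMap.ker P.matC.mulVecLin) P.finrank_ker

/-- The image point `s` is an image of the space point `x`: the vector `P x` is a multiple of `s`.
If `x` is not the camera centre then `P x ≠ 0` and this says `s = P(x)`; if `x` is the camera
centre then `P x = 0` and every `s` qualifies. -/
def IsImage (P : Camera) (x : Space) (s : ImagePlane) : Prop :=
  ∃ c : ℂ, P.matC *ᵥ x.rep = c • s.rep

/-- The `6 × 6` matrix `[P x 0; P' 0 y]`. -/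
noncomputable def pairMatrix (P P' : Camera) (x y : Fin 3 → ℝ) : Matrix (Fin 6) (Fin 6) ℝ :=
  Matrix.reindex (finSumFinEquiv : Fin 3 ⊕ Fin 3 ≃ Fin 6) (finSumFinEquiv : Fin 4 ⊕ Fin 2 ≃ Fin 6)
    (Matrix.fromBlocks P.mat (Matrix.of fun i => ![x i, 0]) P'.mat (Matrix.of fun i => ![0, y i]))

/-- The fundamental matrix of a pair of cameras: the matrix `F` of the bilinear form
`xᵀ F y = det [P x 0; P' 0 y]`. It is meaningful up to a nonzero factor. -/
noncomputable def fundamentalMatrix (P P' : Camera) : Matrix (Fin 3) (Fin 3) ℝ :=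
  Matrix.of fun a b => (pairMatrix P P' (Pi.single a 1) (Pi.single b 1)).det

end Camera

/-! ### Configurations and criticality -/

/-- A configuration of `n` cameras with distinct centres and a set of space points. -/
structure Configuration (n : ℕ) where
  camera : Fin n → Camera
  center_injective : Function.Injective fun i => (camera i).center
  points : Set Space

namespace Configuration

variable {n : ℕ}

/-- `s ∈ (ℙ²)ⁿ` is an image of `x` under the joint camera map. As the centres are distinct, the
pairs `(x, s)` with this property form the closure of the graph of the joint camera map: away from
the centres `s = (P₁(x), …, Pₙ(x))`, and at the `i`-th centre the `i`-th image point is free. -/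
def IsImage (K : Configuration n) (x : Space) (s : Fin n → ImagePlane) : Prop :=
  ∀ i, (K.camera i).IsImage x (s i)

/-- `K` is a reconstruction of the set `S ⊆ (ℙ²)ⁿ`: every element of `S` is an image of a point of
`K`, and every point of `K` has an image in `S`. If no point of `K` is a camera centre, this says
that `S` is the image of the set of points under the joint camera map. -/
def IsReconstruction (K : Configuration n) (S : Set (Fin n → ImagePlane)) : Prop :=
  (∀ s ∈ S, ∃ x ∈ K.points, K.IsImage x s) ∧ (∀ x ∈ K.points, ∃ s ∈ S, K.IsImage x s)

/-- Equivalence of configurations: they differ by a projective transformation of space. Camera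
matrices are compared up to a nonzero factor. -/
def Equivalent (K L : Configuration n) : Prop :=
  ∃ H : GL (Fin 4) ℂ, (fun x : Space => H • x) '' K.points = L.points ∧
    ∀ i, ∃ c : ℂ, c ≠ 0 ∧ (K.camera i).matC * (H⁻¹).val = c • (L.camera i).matC

/-- Conjugate configurations: nonequivalent reconstructions of the same set. -/
def Conjugate (K L : Configuration n) : Prop :=
  (∃ S : Set (Fin n → ImagePlane), K.IsReconstruction S ∧ L.IsReconstruction S) ∧
    ¬ K.Equivalent L

/-- A critical configuration: one that has a conjugate configuration. -/
def IsCritical (K : Configuration n) : Prop :=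
  ∃ L : Configuration n, K.Conjugate L

/-- A non-trivial critical configuration: one that has a conjugate configuration such that, for
every pair of views, the fundamental matrices of the two configurations are different (as matrices
up to a nonzero factor). -/
def IsNontrivialCritical (K : Configuration n) : Prop :=
  ∃ L : Configuration n, K.Conjugate L ∧ ∀ i j, i ≠ j → ¬ ∃ c : ℝ, c ≠ 0 ∧
    (L.camera i).fundamentalMatrix (L.camera j) =
      c • (K.camera i).fundamentalMatrix (K.camera j)

end Configuration

/-! ### Irreducible quartic curves that are intersections of two quadrics -/

/-- `q₁ = q₂ = 0` is an irreducible quartic curve: `q₁, q₂` are linearly independent real quadratic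
forms, and the homogeneous ideal they generate over `ℂ` is prime. Then the two quadrics have no
common component, so that they meet in a curve of degree `4` (Bézout), and this curve is reduced
and irreducible over `ℂ`, with `(q₁, q₂)` as its ideal. Such a curve is either smooth (an elliptic
quartic) or a singular rational quartic (with a node or a cusp). -/
structure IsIrreducibleQuartic (q₁ q₂ : MvPolynomial (Fin 4) ℝ) : Prop where
  homogeneous_left : q₁.IsHomogeneous 2
  homogeneous_right : q₂.IsHomogeneous 2
  linearIndependent : LinearIndependent ℝ ![q₁, q₂]
  isPrime : (Ideal.span {MvPolynomial.map (algebraMap ℝ ℂ) q₁,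
    MvPolynomial.map (algebraMap ℝ ℂ) q₂}).IsPrime

/-- The complex points of the intersection of the two quadrics. -/
def quarticCurve (q₁ q₂ : MvPolynomial (Fin 4) ℝ) : Set Space :=
  {x | MvPolynomial.aeval x.rep q₁ = 0 ∧ MvPolynomial.aeval x.rep q₂ = 0}

/-- The gradient of `q` at (a representative of) `x`. -/
noncomputable def gradient (q : MvPolynomial (Fin 4) ℝ) (x : Space) : Fin 4 → ℂ :=
  fun i => MvPolynomial.aeval x.rep (MvPolynomial.pderiv i q)

/-- Singular points of the curve `q₁ = q₂ = 0`, by the Jacobian criterion (`q₁` and `q₂` generate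
the ideal of the curve): the points of the curve where the gradients are linearly dependent. -/
def IsSingularPoint (q₁ q₂ : MvPolynomial (Fin 4) ℝ) (x : Space) : Prop :=
  x ∈ quarticCurve q₁ q₂ ∧ ¬ LinearIndependent ℂ ![gradient q₁ x, gradient q₂ x]

end Vision

/-!
Choose coordinates in which a camera centre that is a smooth point of the curve is
`(0 : 0 : 0 : 1)` and a suitable auxiliary real point of the curve is `(0 : 0 : 1 : 0)`. The pencil
of quadrics then has a basis `wx + dx² + exy + fy² + gxz + hyz`, `wz + ax² + bxy + cy²`. If
`S₀, S₁, S₂` are the image coordinates of a camera with centre `p` on the curve, a suitable member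
of the pencil has the shape `T₀S₂ - T₂S₀` with linear forms `T₀`, `T₂`, so that
`T₀ : T₂ = S₀ : S₂` on the curve. With the right `T₁`, a camera `(T₀, T₁, T₂)` has the same image
as the given one after moving the points of the curve by a map `(x : y : z : w) ↦ (x : y : z : t)`
that does not depend on `p`.

For any two views some real point has images whose viewing rays under the conjugate cameras are
skew, which separates the fundamental matrices and shows that the configurations are not
equivalent. The degenerate cases are ruled out by the primeness of the ideal: no quadric of the
pencil is a product of two linear forms, and projecting the curve from a smooth point gives a plane
cubic that contains no line.

The auxiliary point has to avoid finitely many planes through the smooth centre. It exists because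
the cubic has odd degree, hence a real point on every line.
-/

namespace Vision

section PrimePencil

open Module QuadraticMap

variable {K V W : Type*} [Field K] [AddCommGroup V] [Module K V] [AddCommGroup W] [Module K W]

/-- Two quadratic forms that are linearly independent and generate a prime ideal, as far as this
can be said in degrees two and three: no nonzero form of the pencil is a product of two linear
forms, and a quadratic form belongs to the pencil as soon as a nonzero linear multiple of it lies
in the ideal. -/
structure PrimePencil (Q₁ Q₂ : QuadraticForm K V) : Prop where
  linearIndependent : LinearIndependent K ![Q₁, Q₂]
  irred : ∀ (α β : K) (a b : Dual K V), linMulLin a b = α • Q₁ + β • Q₂ → a = 0 ∨ b = 0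
  prime : ∀ (a m₁ m₂ : Dual K V) (S : QuadraticForm K V),
    (∀ v, a v * S v = m₁ v * Q₁ v + m₂ v * Q₂ v) → a = 0 ∨ ∃ α β : K, S = α • Q₁ + β • Q₂

/-- A zero of two quadratic forms at which their differentials are linearly independent. -/
structure IsSmoothZero (Q₁ Q₂ : QuadraticForm K V) (p : V) : Prop where
  zero_left : Q₁ p = 0
  zero_right : Q₂ p = 0
  linearIndependent : LinearIndependent K ![Q₁.polarBilin p, Q₂.polarBilin p]

/-- The cubic form `dQ₁(p) Q₂ - dQ₂(p) Q₁`. When `p` is a smooth zero of `Q₁` and `Q₂`, it is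
invariant under translation by `p`, and it is the equation of the projection of the curve
`Q₁ = Q₂ = 0` from `p`. -/
def projectionCubic (Q₁ Q₂ : QuadraticForm K V) (p v : V) : K :=
  Q₁.polarBilin p v * Q₂ v - Q₂.polarBilin p v * Q₁ v

theorem polarBilin_self_of_apply_eq_zero {Q : QuadraticForm K V} {p : V} (h : Q p = 0) :
    Q.polarBilin p p = 0 := by
  rw [polarBilin_apply_apply, polar_self, h, smul_zero]

theorem apply_smul_add_smul_sub_eq_zero {Q : QuadraticForm K V} {p p' : V} (h : Q p = 0)
    (h' : Q p' = 0) (hsub : Q (p - p') = 0) (a b : K) : Q (a • p + b • (p - p')) = 0 := by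
  have hpolar : polar Q p (p - p') = 0 := by
    have h₀ : Q (p - (p - p')) = 0 := by rwa [sub_sub_cancel]
    rwa [sub_eq_add_neg, QuadraticMap.map_add Q, polar_neg_right, QuadraticMap.map_neg, h, hsub,
      add_zero, zero_add, neg_eq_zero] at h₀
  simp only [QuadraticMap.map_add Q, QuadraticMap.map_smul, polar_smul_left, polar_smul_right, h,
    hsub, hpolar, smul_zero, add_zero]

variable {Q₁ Q₂ : QuadraticForm K V} {p : V}

namespace PrimePencil

theorem comp (h : PrimePencil Q₁ Q₂) (e : W ≃ₗ[K] V) :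
    PrimePencil (Q₁.comp e.toLinearMap) (Q₂.comp e.toLinearMap) where
  linearIndependent := LinearIndependent.pair_iff.2 fun α β hαβ =>
    LinearIndependent.pair_iff.1 h.linearIndependent α β <| ext fun v => by
      simpa using congr_fun hαβ (e.symm v)
  irred α β a b hab := by
    refine (h.irred α β (a ∘ₗ e.symm.toLinearMap) (b ∘ₗ e.symm.toLinearMap) ?_).imp ?_ ?_
    · exact ext fun v => by simpa using congr_fun hab (e.symm v)
    all_goals exact fun h0 => LinearMap.ext fun w => by simpa using LinearMap.congr_fun h0 (e w)
  prime a m₁ m₂ S hS := by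
    refine (h.prime (a ∘ₗ e.symm.toLinearMap) (m₁ ∘ₗ e.symm.toLinearMap)
      (m₂ ∘ₗ e.symm.toLinearMap) (S.comp e.symm.toLinearMap) fun v => ?_).imp ?_ ?_
    · simpa using hS (e.symm v)
    · exact fun h0 => LinearMap.ext fun w => by simpa using LinearMap.congr_fun h0 (e w)
    · rintro ⟨α, β, h0⟩
      exact ⟨α, β, ext fun w => by simpa using congr_fun h0 (e w)⟩

theorem change (h : PrimePencil Q₁ Q₂) {s r : K} (hs : s ≠ 0) (hr : r ≠ 0) (t : K) :
    PrimePencil (s • Q₁ + t • Q₂) (r • Q₂) where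
  linearIndependent := LinearIndependent.pair_iff.2 fun α β hαβ => by
    obtain ⟨h₁, h₂⟩ := LinearIndependent.pair_iff.1 h.linearIndependent
      (α * s) (α * t + β * r) (by rw [← hαβ]; module)
    have hα : α = 0 := (mul_eq_zero.1 h₁).resolve_right hs
    rw [hα, zero_mul, zero_add] at h₂
    exact ⟨hα, (mul_eq_zero.1 h₂).resolve_right hr⟩
  irred α β a b hab := h.irred (α * s) (α * t + β * r) a b (by rw [hab]; module)
  prime a m₁ m₂ S hS := by
    refine (h.prime a (s • m₁) (t • m₁ + r • m₂) S fun v => ?_).imp id ?_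
    · simp only [hS, add_apply, smul_apply, LinearMap.add_apply,
        LinearMap.smul_apply, smul_eq_mul]
      ring
    · rintro ⟨α, β, rfl⟩
      refine ⟨α / s, (β - α / s * t) / r, ?_⟩
      match_scalars <;> field_simp
      ring

end PrimePencil

theorem IsSmoothZero.projectionCubic_add_smul (hp : IsSmoothZero Q₁ Q₂ p) (v : V) (t : K) :
    projectionCubic Q₁ Q₂ p (v + t • p) = projectionCubic Q₁ Q₂ p v := by
  simp only [projectionCubic, QuadraticMap.map_add Q₁, QuadraticMap.map_add Q₂,
    QuadraticMap.map_smul, hp.zero_left, hp.zero_right, polarBilin_apply_apply, polar_add_right,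
    polar_smul_right, polar_self, polar_comm Q₁ v, polar_comm Q₂ v, polar_smul_left, smul_eq_mul,
    nsmul_eq_mul]
  ring

theorem exists_dual_forall_eq_mul_add (a : Dual K V) (e : V) (Q : QuadraticForm K V) :
    ∃ b : Dual K V, ∀ v, Q v = a v * b v + Q (v - a v • e) := by
  refine ⟨Q.polarBilin e ∘ₗ (LinearMap.id - a.smulRight e) + Q e • a, fun v => ?_⟩
  have hv : Q v = Q (v - a v • e + a v • e) := by rw [sub_add_cancel]
  rw [hv, QuadraticMap.map_add Q]
  simp only [QuadraticMap.map_smul, polar_smul_right, polar_comm Q _ e, smul_eq_mul,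
    LinearMap.add_apply, LinearMap.smul_apply, LinearMap.comp_apply, LinearMap.sub_apply,
    LinearMap.id_apply, LinearMap.smulRight_apply, polarBilin_apply_apply]
  ring

theorem exists_eq_linMulLin {a : Dual K V} (ha : a ≠ 0) {Q : QuadraticForm K V}
    (hQ : ∀ v, a v = 0 → Q v = 0) : ∃ b : Dual K V, Q = linMulLin a b := by
  obtain ⟨e, he⟩ := LinearMap.surjective ha 1
  obtain ⟨b, hb⟩ := exists_dual_forall_eq_mul_add a e Q
  refine ⟨b, ext fun v => ?_⟩
  rw [hb, hQ (v - a v • e) (by simp [he]), add_zero, linMulLin_apply]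

theorem exists_quadraticForm_forall_mul_eq (a l : Dual K V) (e : V) (Q : QuadraticForm K V) :
    ∃ S : QuadraticForm K V, ∀ v, l v * Q v = a v * S v + l (v - a v • e) * Q (v - a v • e) := by
  obtain ⟨b, hb⟩ := exists_dual_forall_eq_mul_add a e Q
  refine ⟨linMulLin l b + l e • Q.comp (LinearMap.id - a.smulRight e), fun v => ?_⟩
  have hS : Q ((LinearMap.id - a.smulRight e : V →ₗ[K] V) v) = Q (v - a v • e) := rfl
  rw [hb v]
  simp only [add_apply, smul_apply, comp_apply, hS, linMulLin_apply, map_sub, map_smul,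
    smul_eq_mul]
  ring

theorem eq_zero_or_eq_zero_of_forall_mul_eq_zero [NeZero (2 : K)] {a : Dual K V}
    {Q : QuadraticForm K V} (h : ∀ v, a v * Q v = 0) : a = 0 ∨ Q = 0 := by
  refine or_iff_not_imp_left.2 fun ha => ext fun v => ?_
  by_cases hv : a v = 0
  · obtain ⟨f, hf⟩ := LinearMap.surjective ha 1
    have hf₀ : Q f = 0 := by simpa [hf] using h f
    have hadd : Q (v + f) = 0 := by simpa [hv, hf] using h (v + f)
    have hsub : Q (v + -f) = 0 := by simpa [hv, hf] using h (v + -f)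
    rw [QuadraticMap.map_add Q] at hadd hsub
    rw [polar_neg_right, QuadraticMap.map_neg] at hsub
    refine mul_left_cancel₀ (two_ne_zero' K) ?_
    rw [zero_apply]
    linear_combination hadd + hsub - 2 * hf₀
  · exact (mul_eq_zero.1 (h v)).resolve_left hv

namespace PrimePencil

theorem not_forall_projectionCubic_eq_zero [NeZero (2 : K)] (hQ : PrimePencil Q₁ Q₂)
    (hp : LinearIndependent K ![Q₁.polarBilin p, Q₂.polarBilin p]) :
    ¬ ∀ v, projectionCubic Q₁ Q₂ p v = 0 := by
  intro h
  set X := Q₁.polarBilin p with hX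
  set Z := Q₂.polarBilin p with hZ
  rw [LinearIndependent.pair_iff] at hp
  have hX₀ : X ≠ 0 := fun h0 => one_ne_zero (hp 1 0 (by simp [h0])).1
  obtain ⟨e, he⟩ := LinearMap.surjective hX₀ 1
  have hmul : ∀ v : LinearMap.ker X,
      Z.domRestrict (LinearMap.ker X) v * Q₁.comp (LinearMap.ker X).subtype v = 0 := by
    rintro ⟨v, hv⟩
    have hv' : X v = 0 := hv
    simpa [projectionCubic, ← hX, ← hZ, hv'] using h v
  rcases eq_zero_or_eq_zero_of_forall_mul_eq_zero hmul with hZ₀ | hQ₀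
  · refine one_ne_zero (hp (-Z e) 1 (LinearMap.ext fun v => ?_)).2
    have := LinearMap.congr_fun hZ₀ ⟨v - X v • e, by simp [he]⟩
    simp only [LinearMap.domRestrict_apply, map_sub, map_smul, smul_eq_mul,
      LinearMap.zero_apply] at this
    simp only [LinearMap.add_apply, LinearMap.smul_apply, smul_eq_mul, LinearMap.zero_apply]
    linear_combination this
  · obtain ⟨b, hb⟩ := exists_eq_linMulLin hX₀ (Q := Q₁) fun v hv =>
      congr_fun hQ₀ ⟨v, hv⟩
    rcases hQ.irred 1 0 X b (by rw [← hb]; simp) with h0 | h0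
    · exact hX₀ h0
    · refine one_ne_zero (LinearIndependent.pair_iff.1 hQ.linearIndependent 1 0 ?_).1
      rw [hb, h0]
      ext v
      simp

theorem exists_projectionCubic_ne_zero [NeZero (2 : K)] (hQ : PrimePencil Q₁ Q₂)
    (hp : IsSmoothZero Q₁ Q₂ p) {a : Dual K V} (ha : a ≠ 0) (hap : a p = 0) :
    ∃ v, a v = 0 ∧ projectionCubic Q₁ Q₂ p v ≠ 0 := by
  by_contra! hF
  obtain ⟨e, he⟩ := LinearMap.surjective ha 1
  obtain ⟨S₂, hS₂⟩ := exists_quadraticForm_forall_mul_eq a (Q₁.polarBilin p) e Q₂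
  obtain ⟨S₁, hS₁⟩ := exists_quadraticForm_forall_mul_eq a (Q₂.polarBilin p) e Q₁
  have hS : ∀ v, a v * (S₂ - S₁) v = projectionCubic Q₁ Q₂ p v := fun v => by
    have h0 := hF (v - a v • e) (by simp [he])
    rw [projectionCubic] at h0 ⊢
    rw [hS₁, hS₂, sub_apply]
    linear_combination -h0
  obtain ⟨α, β, hαβ⟩ := (hQ.prime a (-Q₂.polarBilin p) (Q₁.polarBilin p) (S₂ - S₁) fun v => by
    rw [hS, projectionCubic, LinearMap.neg_apply]
    ring).resolve_left ha
  have hlin : linMulLin a (α • Q₁.polarBilin p + β • Q₂.polarBilin p)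
      = (0 : K) • Q₁ + (0 : K) • Q₂ := by
    ext v
    have h0 := hp.projectionCubic_add_smul v 1
    rw [← hS, ← hS, hαβ] at h0
    simp only [one_smul, map_add, hap, add_zero, add_apply, smul_apply,
      QuadraticMap.map_add Q₁, QuadraticMap.map_add Q₂, hp.zero_left, hp.zero_right,
      polar_comm _ v, smul_eq_mul] at h0
    simp only [linMulLin_apply, LinearMap.add_apply, LinearMap.smul_apply,
      polarBilin_apply_apply, add_apply, smul_apply, smul_eq_mul]
    linear_combination h0
  obtain ⟨rfl, rfl⟩ := LinearIndependent.pair_iff.1 hp.linearIndependent α β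
    ((hQ.irred 0 0 _ _ hlin).resolve_left ha)
  refine hQ.not_forall_projectionCubic_eq_zero hp.linearIndependent fun v => ?_
  rw [← hS, hαβ]
  simp

end PrimePencil

end PrimePencil

/-- Two vectors are proportional: all their `2 × 2` minors vanish. -/
def Parallel {ι R : Type*} [Mul R] (u v : ι → R) : Prop :=
  ∀ i j, u i * v j = u j * v i

theorem Parallel.refl {ι R : Type*} [CommMagma R] (u : ι → R) : Parallel u u :=
  fun _ _ => mul_comm _ _

theorem parallel_of_minors {R : Type*} [Mul R] {u v : Fin 3 → R}
    (h₀₁ : u 0 * v 1 = u 1 * v 0) (h₀₂ : u 0 * v 2 = u 2 * v 0) (h₁₂ : u 1 * v 2 = u 2 * v 1) :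
    Parallel u v := by
  intro i j
  fin_cases i <;> fin_cases j <;> simp [h₀₁, h₀₂, h₁₂]

/-- The rays `{y | N y ∈ ⟨x⟩}` and `{y | N' y ∈ ⟨x'⟩}` back-projected from the image points `x` and
`x'` do not meet: the matrix `[N x 0; N' 0 x']` has trivial kernel. -/
def SkewRays {m m' n R : Type*} [Fintype n] [CommRing R] (N : Matrix m n R) (N' : Matrix m' n R)
    (x : m → R) (x' : m' → R) : Prop :=
  ∀ (y : n → R) (s t : R), N *ᵥ y = s • x → N' *ᵥ y = t • x' → y = 0 ∧ s = 0 ∧ t = 0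

/-- Coefficients of the normal form `wx + dx² + exy + fy² + gxz + hyz`, `wz + ax² + bxy + cy²` of
a pencil of quadrics through `(0 : 0 : 1 : 0)` and `(0 : 0 : 0 : 1)`. -/
structure QuarticCoeff (k : Type*) where
  (a b c d e f g h : k)

namespace QuarticCoeff

section CommRing

variable {k : Type*} [CommRing k] (q : QuarticCoeff k)

/-- The first quadratic form of the normal form. -/
def form₁ : QuadraticForm k (Fin 4 → k) :=
  QuadraticMap.proj 3 0 + q.d • QuadraticMap.proj 0 0 + q.e • QuadraticMap.proj 0 1
    + q.f • QuadraticMap.proj 1 1 + q.g • QuadraticMap.proj 0 2 + q.h • QuadraticMap.proj 1 2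

/-- The second quadratic form of the normal form. -/
def form₂ : QuadraticForm k (Fin 4 → k) :=
  QuadraticMap.proj 3 2 + q.a • QuadraticMap.proj 0 0 + q.b • QuadraticMap.proj 0 1
    + q.c • QuadraticMap.proj 1 1

/-- The projection from `(0 : 0 : 0 : 1)`. -/
def baseCamera (k : Type*) [CommRing k] : Matrix (Fin 3) (Fin 4) k :=
  !![1, 0, 0, 0; 0, 1, 0, 0; 0, 0, 1, 0]

/-- A projection from the point `p`, when `p 0 = 1`. -/
def sourceCamera (p : Fin 4 → k) : Matrix (Fin 3) (Fin 4) k :=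
  !![p 1, -1, 0, 0; p 2, 0, -1, 0; -p 3, 0, 0, 1]

/-- The value at `p` of the linear form `gx + hy`, which together with `z` gives the tangent line
of the curve at `(0 : 0 : 1 : 0)`. -/
def sigma (p : Fin 4 → k) : k := q.g + q.h * p 1

/-- The coefficient of `y²` in the member `p 3 * form₁ - sigma p * form₂` of the pencil. -/
def beta (p : Fin 4 → k) : k := p 3 * q.f - q.sigma p * q.c

/-- The camera that is conjugate to `sourceCamera p`, when `baseCamera` is conjugate to itself. -/
def targetCamera (p : Fin 4 → k) : Matrix (Fin 3) (Fin 4) k :=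
  !![p 3, 0, -q.sigma p, 0;
    -(q.b + q.c * p 1), -q.c, q.f * p 1, -1;
    p 3 * q.e - q.sigma p * q.b + q.beta p * p 1, q.beta p, p 3 * q.h, 0]

/-- `p` is a point of the curve `form₁ = form₂ = 0` in the affine chart `x = 1`. -/
structure OnCurve (p : Fin 4 → k) : Prop where
  affine : p 0 = 1
  zero₁ : q.form₁ p = 0
  zero₂ : q.form₂ p = 0

theorem form₁_apply (v : Fin 4 → k) : q.form₁ v =
    v 3 * v 0 + q.d * v 0 ^ 2 + q.e * v 0 * v 1 + q.f * v 1 ^ 2 + q.g * v 0 * v 2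
      + q.h * v 1 * v 2 := by
  simp only [form₁, add_apply, smul_apply, QuadraticMap.proj_apply, smul_eq_mul]
  ring

theorem form₂_apply (v : Fin 4 → k) :
    q.form₂ v = v 3 * v 2 + q.a * v 0 ^ 2 + q.b * v 0 * v 1 + q.c * v 1 ^ 2 := by
  simp only [form₂, add_apply, smul_apply, QuadraticMap.proj_apply, smul_eq_mul]
  ring

theorem baseCamera_mulVec (v : Fin 4 → k) : baseCamera k *ᵥ v = ![v 0, v 1, v 2] := by
  ext i
  fin_cases i <;> simp [baseCamera, Matrix.mulVec, dotProduct, Fin.sum_univ_four]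

theorem sourceCamera_mulVec (p v : Fin 4 → k) : sourceCamera p *ᵥ v =
    ![p 1 * v 0 - v 1, p 2 * v 0 - v 2, v 3 - p 3 * v 0] := by
  ext i
  fin_cases i <;> simp [sourceCamera, Matrix.mulVec, dotProduct, Fin.sum_univ_four] <;> ring

theorem targetCamera_mulVec (p v : Fin 4 → k) : q.targetCamera p *ᵥ v =
    ![p 3 * v 0 - q.sigma p * v 2,
      -(v 3 + (q.b + q.c * p 1) * v 0 + q.c * v 1 - q.f * p 1 * v 2),
      (p 3 * q.e - q.sigma p * q.b + q.beta p * p 1) * v 0 + q.beta p * v 1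
        + p 3 * q.h * v 2] := by
  ext i
  fin_cases i <;> simp [targetCamera, Matrix.mulVec, dotProduct, Fin.sum_univ_four] <;> ring

variable {q}

theorem OnCurve.d_eq {p : Fin 4 → k} (hp : q.OnCurve p) :
    q.d = -(p 3 + q.e * p 1 + q.f * p 1 ^ 2 + q.sigma p * p 2) := by
  have h := hp.zero₁
  simp only [form₁_apply, hp.affine] at h
  simp only [sigma]
  linear_combination h

theorem OnCurve.a_eq {p : Fin 4 → k} (hp : q.OnCurve p) :
    q.a = -(p 3 * p 2 + q.b * p 1 + q.c * p 1 ^ 2) := by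
  have h := hp.zero₂
  simp only [form₂_apply, hp.affine] at h
  linear_combination h

theorem OnCurve.mul_form₁_sub_mul_form₂ {p : Fin 4 → k} (hp : q.OnCurve p) (v : Fin 4 → k) :
    p 3 * q.form₁ v - q.sigma p * q.form₂ v =
      (q.targetCamera p *ᵥ v) 0 * (sourceCamera p *ᵥ v) 2
        - (q.targetCamera p *ᵥ v) 2 * (sourceCamera p *ᵥ v) 0 := by
  simp only [form₁_apply, form₂_apply, targetCamera_mulVec, sourceCamera_mulVec, hp.a_eq, hp.d_eq,
    Matrix.cons_val, beta, sigma]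
  ring

end CommRing

section ConjugatePoint

variable {k : Type*} [Field k] {q : QuarticCoeff k} {v : Fin 4 → k} {t : k}

variable (q v t) in
/-- The point `(x : y : z : t)` is conjugate to the point `v = (x : y : z : w)` of the curve. The
map `v ↦ t` is the rational function given by two fractions, of which at least one is defined
where `x` and `y` do not both vanish. -/
def IsConjugateCoord : Prop :=
  t * v 0 + v 2 * (q.e * v 0 + q.f * v 1 + q.h * v 2) = 0 ∧
    t * v 1 + (q.a * v 0 ^ 2 + q.b * v 0 * v 1 + q.c * v 1 ^ 2 - q.d * v 0 * v 2
      - q.g * v 2 ^ 2) = 0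

theorem exists_isConjugateCoord (h₁ : q.form₁ v = 0) (h₂ : q.form₂ v = 0)
    (hv : v 0 ≠ 0 ∨ v 1 ≠ 0) : ∃ t, q.IsConjugateCoord v t := by
  simp only [form₁_apply, form₂_apply] at h₁ h₂
  rcases hv with h | h
  · refine ⟨-(v 2 * (q.e * v 0 + q.f * v 1 + q.h * v 2)) / v 0, by field_simp; ring, ?_⟩
    field_simp
    linear_combination v 0 * h₂ - v 2 * h₁
  · refine ⟨-(q.a * v 0 ^ 2 + q.b * v 0 * v 1 + q.c * v 1 ^ 2 - q.d * v 0 * v 2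
      - q.g * v 2 ^ 2) / v 1, ?_, by field_simp; ring⟩
    field_simp
    linear_combination v 2 * h₁ - v 0 * h₂

theorem IsConjugateCoord.bilinear_relation (ht : q.IsConjugateCoord v t) (h₁ : q.form₁ v = 0)
    (h₂ : q.form₂ v = 0) (hv : v 0 ≠ 0 ∨ v 1 ≠ 0) :
    t * v 3 + q.c * v 3 * v 1 + q.c * q.d * v 0 * v 1 + q.c * q.g * v 1 * v 2
      - q.e * q.a * v 0 ^ 2 - q.e * q.b * v 0 * v 1
      - (q.f * v 1 + q.h * v 2) * (q.a * v 0 + q.b * v 1) = 0 := by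
  obtain ⟨ht₀, ht₁⟩ := ht
  simp only [form₁_apply, form₂_apply] at h₁ h₂
  rcases hv with hv | hv
  · refine mul_left_cancel₀ hv ?_
    linear_combination v 3 * ht₀ + q.c * v 1 * h₁ - (q.e * v 0 + q.f * v 1 + q.h * v 2) * h₂
  · refine mul_left_cancel₀ hv ?_
    linear_combination v 3 * ht₁ - (q.a * v 0 + q.b * v 1 - q.d * v 2) * h₁
      + q.g * v 2 * h₂ + q.d * (v 0 * h₂ - v 2 * h₁)

theorem IsConjugateCoord.parallel {p : Fin 4 → k} (ht : q.IsConjugateCoord v t)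
    (hp : q.OnCurve p) (h₁ : q.form₁ v = 0) (h₂ : q.form₂ v = 0) (hv : v 0 ≠ 0 ∨ v 1 ≠ 0) :
    Parallel (sourceCamera p *ᵥ v) (q.targetCamera p *ᵥ ![v 0, v 1, v 2, t]) := by
  have hb := ht.bilinear_relation h₁ h₂ hv
  obtain ⟨ht₀, ht₁⟩ := ht
  rw [form₁_apply] at h₁
  rw [form₂_apply] at h₂
  rw [hp.d_eq] at h₁ ht₁ hb
  rw [hp.a_eq] at h₂ ht₁ hb
  rw [sourceCamera_mulVec, targetCamera_mulVec]
  simp only [beta, sigma] at *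
  apply parallel_of_minors <;> simp only [Matrix.cons_val]
  · linear_combination (-p 1) * ht₀ + ht₁
  · linear_combination (-p 3) * h₁ + (q.g + q.h * p 1) * h₂
  · linear_combination hb - p 3 * ht₀ + (q.b + q.c * p 1) * h₁ - q.f * p 1 * h₂

theorem exists_conjugate_point (h₁ : q.form₁ v = 0) (h₂ : q.form₂ v = 0) :
    ∃ y : Fin 4 → k, y ≠ 0 ∧ Parallel (baseCamera k *ᵥ v) (baseCamera k *ᵥ y) ∧
      ∀ p, q.OnCurve p → Parallel (sourceCamera p *ᵥ v) (q.targetCamera p *ᵥ y) := by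
  by_cases hv : v 0 ≠ 0 ∨ v 1 ≠ 0
  · obtain ⟨t, ht⟩ := exists_isConjugateCoord h₁ h₂ hv
    refine ⟨![v 0, v 1, v 2, t], fun h => ?_, ?_, fun p hp => ht.parallel hp h₁ h₂ hv⟩
    · exact hv.elim (fun h' => h' (congrFun h 0)) (fun h' => h' (congrFun h 1))
    · rw [baseCamera_mulVec, baseCamera_mulVec]
      exact Parallel.refl _
  push Not at hv
  obtain ⟨hv₀, hv₁⟩ := hv
  by_cases hv₂ : v 2 = 0
  · refine ⟨![0, 1, 0, -q.c], fun h => one_ne_zero (congrFun h 1), ?_, fun p _ => ?_⟩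
    · rw [baseCamera_mulVec, baseCamera_mulVec]
      apply parallel_of_minors <;> simp [hv₀, hv₁, hv₂]
    · rw [sourceCamera_mulVec, targetCamera_mulVec]
      apply parallel_of_minors <;> simp [hv₀, hv₁, hv₂]
  · have hv₃ : v 3 = 0 := by simpa [form₂_apply, hv₀, hv₁, hv₂] using h₂
    refine ⟨![0, 0, 0, 1], fun h => one_ne_zero (congrFun h 3), ?_, fun p _ => ?_⟩
    · rw [baseCamera_mulVec, baseCamera_mulVec]
      apply parallel_of_minors <;> simp
    · rw [sourceCamera_mulVec, targetCamera_mulVec]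
      apply parallel_of_minors <;> simp [hv₀, hv₁, hv₃]

end ConjugatePoint
end QuarticCoeff

theorem SkewRays.symm {m m' n R : Type*} [Fintype n] [CommRing R] {N : Matrix m n R}
    {N' : Matrix m' n R} {x : m → R} {x' : m' → R} (h : SkewRays N N' x x') :
    SkewRays N' N x' x := fun y s t hs ht =>
  have ⟨hy, h₁, h₂⟩ := h y t s ht hs
  ⟨hy, h₂, h₁⟩

namespace QuarticCoeff

section Nondegenerate

variable {k : Type*} [Field k] {q : QuarticCoeff k} {p p' : Fin 4 → k}

theorem c_ne_zero_or_f_ne_zero (hq : PrimePencil q.form₁ q.form₂) : q.c ≠ 0 ∨ q.f ≠ 0 := by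
  by_contra! hcf
  obtain ⟨hc, hf⟩ := hcf
  rcases hq.prime (LinearMap.proj 0) (LinearMap.proj 3) (-q.h • LinearMap.proj 1)
    (.proj 3 3 + q.d • .proj 3 0 + q.e • .proj 3 1 + q.g • .proj 3 2
      - (q.h * q.a) • .proj 0 1 - (q.h * q.b) • .proj 1 1) (fun v => by
      simp only [form₁_apply, form₂_apply, add_apply, sub_apply, smul_apply,
        QuadraticMap.proj_apply, LinearMap.proj_apply, LinearMap.smul_apply, smul_eq_mul, hc, hf]
      ring) with h | ⟨α, β, h⟩
  · simpa using LinearMap.congr_fun h ![1, 0, 0, 0]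
  · simpa [form₁_apply, form₂_apply] using QuadraticMap.congr_fun h ![0, 0, 0, 1]

theorem g_ne_zero_or_h_ne_zero (hq : PrimePencil q.form₁ q.form₂) (hf : q.f = 0) :
    q.g ≠ 0 ∨ q.h ≠ 0 := by
  by_contra! hgh
  obtain ⟨hg, hh⟩ := hgh
  rcases hq.irred 1 0 (LinearMap.proj 0)
    (LinearMap.proj 3 + q.d • LinearMap.proj 0 + q.e • LinearMap.proj 1)
    (QuadraticMap.ext fun v => by simp [form₁_apply, hf, hg, hh]; ring) with h | h
  · simpa using LinearMap.congr_fun h ![1, 0, 0, 0]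
  · simpa using LinearMap.congr_fun h ![0, 0, 0, 1]

theorem polarBilin_form₁_apex (v : Fin 4 → k) : q.form₁.polarBilin ![0, 0, 0, 1] v = v 0 := by
  simp only [QuadraticMap.polarBilin_apply_apply, QuadraticMap.polar, form₁_apply, Pi.add_apply,
    Matrix.cons_val]
  ring

theorem polarBilin_form₂_apex (v : Fin 4 → k) : q.form₂.polarBilin ![0, 0, 0, 1] v = v 2 := by
  simp only [QuadraticMap.polarBilin_apply_apply, QuadraticMap.polar, form₂_apply, Pi.add_apply,
    Matrix.cons_val]
  ring

theorem isSmoothZero_apex : IsSmoothZero q.form₁ q.form₂ ![0, 0, 0, 1] where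
  zero_left := by simp [form₁_apply]
  zero_right := by simp [form₂_apply]
  linearIndependent := LinearIndependent.pair_iff.2 fun α β h => by
    have h₀ := LinearMap.congr_fun h ![1, 0, 0, 0]
    have h₁ := LinearMap.congr_fun h ![0, 0, 1, 0]
    simp only [LinearMap.add_apply, LinearMap.smul_apply, polarBilin_form₁_apex,
      polarBilin_form₂_apex] at h₀ h₁
    exact ⟨by simpa using h₀, by simpa using h₁⟩

theorem projectionCubic_apex (v : Fin 4 → k) :
    projectionCubic q.form₁ q.form₂ ![0, 0, 0, 1] v = v 0 * q.form₂ v - v 2 * q.form₁ v := by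
  rw [projectionCubic, polarBilin_form₁_apex, polarBilin_form₂_apex]

variable [NeZero (2 : k)]

theorem three_ne_zero_or_sigma_ne_zero (hq : PrimePencil q.form₁ q.form₂) (hp : q.OnCurve p) :
    p 3 ≠ 0 ∨ q.sigma p ≠ 0 := by
  by_contra! h
  obtain ⟨hw, hs⟩ := h
  have ha := hp.a_eq
  have hd := hp.d_eq
  rw [hw] at ha
  rw [hw, hs] at hd
  obtain ⟨v, hv, hF⟩ := hq.exists_projectionCubic_ne_zero isSmoothZero_apex
    (a := p 1 • LinearMap.proj 0 - LinearMap.proj 1)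
    (fun h => by simpa using LinearMap.congr_fun h ![0, 1, 0, 0]) (by simp)
  have hv₁ : v 1 = p 1 * v 0 := (sub_eq_zero.1 hv).symm
  rw [sigma] at hs
  refine hF ?_
  rw [projectionCubic_apex, form₁_apply, form₂_apply, hv₁, ha, hd]
  linear_combination (-v 0 * v 2 ^ 2) * hs

theorem targetCamera_two_ne_smul_zero (hq : PrimePencil q.form₁ q.form₂) (hp : q.OnCurve p)
    (κ : k) : (q.targetCamera p).row 2 ≠ κ • (q.targetCamera p).row 0 := by
  intro h
  have hmul (v : Fin 4 → k) : (q.targetCamera p *ᵥ v) 2 = κ * (q.targetCamera p *ᵥ v) 0 :=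
    (congrArg (· ⬝ᵥ v) h).trans (smul_dotProduct ..)
  rcases hq.irred (p 3) (-q.sigma p) (p 3 • LinearMap.proj 0 - q.sigma p • LinearMap.proj 2)
    (LinearMap.proj 3 - (p 3 + κ * p 1) • LinearMap.proj 0 + κ • LinearMap.proj 1)
    (QuadraticMap.ext fun v => by
      have hform := hp.mul_form₁_sub_mul_form₂ v
      rw [hmul, targetCamera_mulVec, sourceCamera_mulVec] at hform
      simp only [QuadraticMap.linMulLin_apply, LinearMap.sub_apply, LinearMap.add_apply,
        LinearMap.smul_apply, LinearMap.proj_apply, add_apply, smul_apply, smul_eq_mul,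
        Matrix.cons_val] at hform ⊢
      linear_combination -hform) with h | h
  · rcases three_ne_zero_or_sigma_ne_zero hq hp with h' | h'
    · exact h' (by simpa using LinearMap.congr_fun h ![1, 0, 0, 0])
    · exact h' (by simpa using LinearMap.congr_fun h ![0, 0, 1, 0])
  · simpa using LinearMap.congr_fun h ![0, 0, 0, 1]

theorem linearIndependent_row_targetCamera (hq : PrimePencil q.form₁ q.form₂)
    (hp : q.OnCurve p) : LinearIndependent k (q.targetCamera p).row := by
  refine Fintype.linearIndependent_iff.2 fun r hr => ?_
  have hr₁ : r 1 = 0 := by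
    simpa [targetCamera, Fin.sum_univ_three] using congrFun hr 3
  rw [Fin.sum_univ_three, hr₁, zero_smul, add_zero] at hr
  have hr₂ : r 2 = 0 := by
    by_contra h
    refine targetCamera_two_ne_smul_zero hq hp (-r 0 / r 2) ?_
    rw [div_eq_inv_mul, mul_smul, neg_smul, ← eq_neg_of_add_eq_zero_right hr, inv_smul_smul₀ h]
  rw [hr₂, zero_smul, add_zero] at hr
  have hr₀ : r 0 = 0 := by
    rcases three_ne_zero_or_sigma_ne_zero hq hp with h | h
    · simpa [targetCamera, h] using congrFun hr 0
    · simpa [targetCamera, h] using congrFun hr 2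
  intro i
  fin_cases i
  exacts [hr₀, hr₁, hr₂]

theorem beta_ne_zero_or_beta_ne_zero (hq : PrimePencil q.form₁ q.form₂) (hp : q.OnCurve p)
    (hp' : q.OnCurve p') (hne : p 1 ≠ p' 1) : q.beta p ≠ 0 ∨ q.beta p' ≠ 0 := by
  by_contra! h
  obtain ⟨h, h'⟩ := h
  by_cases hf : q.f = 0
  · have hc : q.c ≠ 0 := (c_ne_zero_or_f_ne_zero hq).resolve_right (not_not.2 hf)
    simp only [beta, hf, mul_zero, zero_sub, neg_eq_zero, mul_eq_zero, hc, or_false, sigma]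
      at h h'
    have hh : q.h = 0 := by
      have : q.h * (p 1 - p' 1) = 0 := by linear_combination h - h'
      simpa [sub_ne_zero.2 hne] using this
    have hg : q.g = 0 := by simpa [hh] using h
    exact (g_ne_zero_or_h_ne_zero hq hf).elim (· hg) (· hh)
  · have hdet : q.b * q.f ^ 2 - q.e * q.f * q.c - q.h * q.c ^ 2 = 0 := by
      refine mul_left_cancel₀ (sub_ne_zero.2 hne) ?_
      have ha := hp.a_eq
      have ha' := hp'.a_eq
      have hd := hp.d_eq
      have hd' := hp'.d_eq
      simp only [beta, sigma] at *
      linear_combination q.f ^ 2 * (ha - ha') - q.f * q.c * (hd - hd')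
        + (q.c - q.f * p 2) * h - (q.c - q.f * p' 2) * h'
    have hw : p 3 = q.sigma p * q.c / q.f := by
      rw [beta] at h
      field_simp
      linear_combination h
    refine targetCamera_two_ne_smul_zero hq hp (-(q.h * q.c / q.f)) ?_
    ext j
    fin_cases j <;>
      simp only [targetCamera, Matrix.row_apply, Matrix.of_apply, Fin.zero_eta, Fin.mk_one,
        Fin.reduceFinMk, Matrix.cons_val, Pi.smul_apply, smul_eq_mul, h, hw]
    · field_simp
      linear_combination (-q.sigma p) * hdet
    · simp
    · field_simp
    · simp

theorem eq_zero_of_targetCamera_mulVec_eq_zero (hq : PrimePencil q.form₁ q.form₂)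
    (hp : q.OnCurve p) (hp' : q.OnCurve p') (hne : p 1 ≠ p' 1) {y : Fin 4 → k}
    (h : q.targetCamera p *ᵥ y = 0) (h' : q.targetCamera p' *ᵥ y = 0) : y = 0 := by
  rw [targetCamera_mulVec] at h h'
  have e₀ := congrFun h 0
  have e₁ := congrFun h 1
  have e₂ := congrFun h 2
  have e₀' := congrFun h' 0
  have e₁' := congrFun h' 1
  have e₂' := congrFun h' 2
  simp only [Matrix.cons_val, Pi.zero_apply] at e₀ e₁ e₂ e₀' e₁' e₂'
  have hcf : q.c * y 0 = q.f * y 2 := by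
    refine mul_left_cancel₀ (sub_ne_zero.2 hne) ?_
    linear_combination e₁' - e₁
  have hβ (r : Fin 4 → k) (hr : r 3 * y 0 - q.sigma r * y 2 = 0) :
      q.beta r * y 0 = 0 ∧ q.beta r * y 2 = 0 :=
    ⟨by rw [beta]; linear_combination q.f * hr - q.sigma r * hcf,
      by rw [beta]; linear_combination q.c * hr - r 3 * hcf⟩
  have eq_zero {t : k} (h : q.beta p * t = 0) (h' : q.beta p' * t = 0) : t = 0 :=
    (beta_ne_zero_or_beta_ne_zero hq hp hp' hne).elim (mul_eq_zero.1 h).resolve_left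
      (mul_eq_zero.1 h').resolve_left
  have hy₀ : y 0 = 0 := eq_zero (hβ p e₀).1 (hβ p' e₀').1
  have hy₂ : y 2 = 0 := eq_zero (hβ p e₀).2 (hβ p' e₀').2
  rw [hy₀, hy₂] at e₁ e₂ e₂'
  have hy₁ : y 1 = 0 := eq_zero (by linear_combination e₂) (by linear_combination e₂')
  have hy₃ : y 3 = 0 := by
    rw [hy₁] at e₁
    linear_combination -e₁
  ext i
  fin_cases i
  exacts [hy₀, hy₁, hy₂, hy₃]

/-- Otherwise the projection from `(0 : 0 : 0 : 1)` maps a line of the curve into the plane cubic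
that is the image of the curve. -/
theorem form₁_sub_ne_zero_or_form₂_sub_ne_zero (hq : PrimePencil q.form₁ q.form₂)
    (hp : q.OnCurve p) (hp' : q.OnCurve p') (hne : p 1 ≠ p' 1) :
    q.form₁ (p - p') ≠ 0 ∨ q.form₂ (p - p') ≠ 0 := by
  by_contra! h
  have hΔ := sub_ne_zero.2 hne
  obtain ⟨v, hv, hF⟩ := hq.exists_projectionCubic_ne_zero isSmoothZero_apex
    (a := LinearMap.proj 2 - p 2 • LinearMap.proj 0
      - ((p 2 - p' 2) / (p 1 - p' 1)) • (LinearMap.proj 1 - p 1 • LinearMap.proj 0))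
    (fun h => by simpa using LinearMap.congr_fun h ![0, 0, 1, 0]) (by simp)
  set μ := (v 1 - p 1 * v 0) / (p 1 - p' 1) with hμ
  have hμΔ : μ * (p 1 - p' 1) = v 1 - p 1 * v 0 := div_mul_cancel₀ _ hΔ
  set ν := v 3 - v 0 * p 3 - μ * (p 3 - p' 3) with hν
  set u := v 0 • p + μ • (p - p') with hu
  have hvu : v = u + ν • ![0, 0, 0, 1] := by
    simp only [LinearMap.sub_apply, LinearMap.smul_apply, LinearMap.proj_apply, smul_eq_mul] at hv
    ext i
    fin_cases i <;>
      simp only [hu, hν, hp.affine, hp'.affine, Pi.add_apply, Pi.smul_apply, Pi.sub_apply,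
        smul_eq_mul, Fin.zero_eta, Fin.mk_one, Fin.reduceFinMk, Matrix.cons_val]
    · simp
    · linear_combination -hμΔ
    · rw [hμ]
      linear_combination hv
    · ring
  refine hF ?_
  rw [hvu, isSmoothZero_apex.projectionCubic_add_smul, projectionCubic_apex,
    apply_smul_add_smul_sub_eq_zero hp.zero₁ hp'.zero₁ h.1,
    apply_smul_add_smul_sub_eq_zero hp.zero₂ hp'.zero₂ h.2]
  ring

end Nondegenerate

section SkewRays

variable {k : Type*} [Field k] {q : QuarticCoeff k} {p p' : Fin 4 → k}

theorem skewRays_baseCamera (hp : q.OnCurve p) {v : Fin 4 → k}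
    (hv : p 3 * q.form₁ v - q.sigma p * q.form₂ v ≠ 0) :
    SkewRays (baseCamera k) (q.targetCamera p) (baseCamera k *ᵥ v) (sourceCamera p *ᵥ v) := by
  intro y s t h h'
  rw [hp.mul_form₁_sub_mul_form₂, sourceCamera_mulVec, targetCamera_mulVec] at hv
  rw [baseCamera_mulVec, baseCamera_mulVec] at h
  rw [targetCamera_mulVec, sourceCamera_mulVec] at h'
  have e₀ := congrFun h 0
  have e₁ := congrFun h 1
  have e₂ := congrFun h 2
  have e₀' := congrFun h' 0
  have e₁' := congrFun h' 1
  have e₂' := congrFun h' 2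
  simp only [Matrix.cons_val, Pi.smul_apply, smul_eq_mul] at hv e₀ e₁ e₂ e₀' e₁' e₂'
  rw [e₀, e₁, e₂] at e₂'
  rw [e₀, e₂] at e₀'
  have hs : s = 0 := (mul_eq_zero.1 (by
    linear_combination (v 3 - p 3 * v 0) * e₀' - (p 1 * v 0 - v 1) * e₂')).resolve_right hv
  have ht : t = 0 := (mul_eq_zero.1 (by
    linear_combination
      ((p 3 * q.e - q.sigma p * q.b + q.beta p * p 1) * v 0 + q.beta p * v 1
        + p 3 * q.h * v 2) * e₀' - (p 3 * v 0 - q.sigma p * v 2) * e₂')).resolve_right hv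
  subst hs ht
  rw [zero_mul] at e₀ e₁ e₂
  rw [e₀, e₁, e₂] at e₁'
  have hy₃ : y 3 = 0 := by linear_combination -e₁'
  refine ⟨?_, rfl, rfl⟩
  ext i
  fin_cases i
  exacts [e₀, e₁, e₂, hy₃]

theorem exists_skewRays_baseCamera [NeZero (2 : k)] (hq : PrimePencil q.form₁ q.form₂)
    (hp : q.OnCurve p) : ∃ v, SkewRays (baseCamera k) (q.targetCamera p) (baseCamera k *ᵥ v)
      (sourceCamera p *ᵥ v) := by
  by_contra! h
  have hzero : p 3 • q.form₁ + -q.sigma p • q.form₂ = 0 := QuadraticMap.ext fun v => by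
    have hv := not_imp_comm.1 (skewRays_baseCamera hp) (h v)
    simpa [sub_eq_add_neg] using hv
  have ⟨h₃, hσ⟩ := LinearIndependent.pair_iff.1 hq.linearIndependent _ _ hzero
  exact (three_ne_zero_or_sigma_ne_zero hq hp).elim (· h₃) (· (neg_eq_zero.1 hσ))

variable (q p p') in
/-- The linear system satisfied by `(y 0, y 2, s, t)` when `q.targetCamera p` maps `y` to
`s • sourceCamera p *ᵥ v` and `q.targetCamera p'` maps `y` to `t • sourceCamera p' *ᵥ v`; the
coordinates `y 1` and `y 3` have been eliminated. -/
def eliminationMatrix (v : Fin 4 → k) : Matrix (Fin 4) (Fin 4) k :=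
  !![p 3, -q.sigma p, -(p 1 * v 0 - v 1), 0;
    p' 3, -q.sigma p', 0, -(p' 1 * v 0 - v 1);
    q.c * (p 1 - p' 1), -(q.f * (p 1 - p' 1)), p 2 * v 0 - v 2, -(p' 2 * v 0 - v 2);
    q.beta p' * (p 3 * q.e - q.sigma p * q.b + q.beta p * p 1)
        - q.beta p * (p' 3 * q.e - q.sigma p' * q.b + q.beta p' * p' 1),
      q.h * (q.beta p' * p 3 - q.beta p * p' 3),
      -(q.beta p' * (v 3 - p 3 * v 0)), q.beta p * (v 3 - p' 3 * v 0)]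

theorem eliminationMatrix_mulVec_eq_zero {v y : Fin 4 → k} {s t : k}
    (h : q.targetCamera p *ᵥ y = s • sourceCamera p *ᵥ v)
    (h' : q.targetCamera p' *ᵥ y = t • sourceCamera p' *ᵥ v) :
    q.eliminationMatrix p p' v *ᵥ ![y 0, y 2, s, t] = 0 := by
  rw [targetCamera_mulVec, sourceCamera_mulVec] at h h'
  have e₀ := congrFun h 0
  have e₁ := congrFun h 1
  have e₂ := congrFun h 2
  have e₀' := congrFun h' 0
  have e₁' := congrFun h' 1
  have e₂' := congrFun h' 2
  simp only [Matrix.cons_val, Pi.smul_apply, smul_eq_mul] at e₀ e₁ e₂ e₀' e₁' e₂'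
  ext i
  fin_cases i <;>
    simp only [eliminationMatrix, Matrix.mulVec, dotProduct, Fin.sum_univ_four, Matrix.of_apply,
      Fin.zero_eta, Fin.mk_one, Fin.reduceFinMk, Matrix.cons_val, Pi.zero_apply]
  · linear_combination e₀
  · linear_combination e₀'
  · linear_combination e₁' - e₁
  · linear_combination q.beta p' * e₂ - q.beta p * e₂'

theorem skewRays_of_det_eliminationMatrix_ne_zero [NeZero (2 : k)]
    (hq : PrimePencil q.form₁ q.form₂) (hp : q.OnCurve p) (hp' : q.OnCurve p')
    (hne : p 1 ≠ p' 1) {v : Fin 4 → k} (hv : (q.eliminationMatrix p p' v).det ≠ 0) :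
    SkewRays (q.targetCamera p) (q.targetCamera p') (sourceCamera p *ᵥ v)
      (sourceCamera p' *ᵥ v) := by
  intro y s t h h'
  have hz : ![y 0, y 2, s, t] = 0 :=
    Matrix.eq_zero_of_mulVec_eq_zero hv (eliminationMatrix_mulVec_eq_zero h h')
  have hs : s = 0 := congrFun hz 2
  have ht : t = 0 := congrFun hz 3
  refine ⟨eq_zero_of_targetCamera_mulVec_eq_zero hq hp hp' hne ?_ ?_, hs, ht⟩
  · rw [h, hs, zero_smul]
  · rw [h', ht, zero_smul]

theorem mul_beta_sub_beta_eq_zero (h : ∀ v, (q.eliminationMatrix p p' v).det = 0) :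
    (p 3 * q.sigma p' - p' 3 * q.sigma p) * (q.beta p - q.beta p') = 0 := by
  have e := h ![0, 0, 1, 1]
  simp [eliminationMatrix, Matrix.det_succ_row_zero, Fin.sum_univ_succ, Fin.succAbove] at e
  linear_combination e

theorem beta_mul_beta_mul_sq_eq (h : ∀ v, (q.eliminationMatrix p p' v).det = 0) :
    q.beta p * q.beta p' * (p 1 - p' 1) ^ 2 =
      (p 3 * q.sigma p' - p' 3 * q.sigma p) * (p 2 * q.beta p - p' 2 * q.beta p') := by
  have hβ : q.beta p = p 3 * q.f - q.sigma p * q.c := rfl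
  have e := h ![1, p 1, 0, 1]
  have e' := h ![1, p 1, 0, 0]
  simp [eliminationMatrix, Matrix.det_succ_row_zero, Fin.sum_univ_succ, Fin.succAbove] at e e'
  linear_combination e - e' + q.beta p' * (p 1 - p' 1) ^ 2 * hβ

theorem beta_eq_zero_of_beta_eq_zero [NeZero (2 : k)] (hq : PrimePencil q.form₁ q.form₂)
    (hp : q.OnCurve p) (hω : p 3 * q.sigma p' = p' 3 * q.sigma p) (h : q.beta p = 0) :
    q.beta p' = 0 := by
  rw [beta] at h ⊢
  rcases three_ne_zero_or_sigma_ne_zero hq hp with h0 | h0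
  · exact mul_left_cancel₀ h0 (by linear_combination p' 3 * h - q.c * hω)
  · exact mul_left_cancel₀ h0 (by linear_combination q.sigma p' * h - q.f * hω)

theorem form₁_sub_eq_zero_and_form₂_sub_eq_zero (hp : q.OnCurve p) (hp' : q.OnCurve p')
    (hβ : q.beta p = q.beta p') (h0 : q.beta p ≠ 0)
    (h : q.beta p * (p 1 - p' 1) ^ 2 =
      (p 3 * q.sigma p' - p' 3 * q.sigma p) * (p 2 - p' 2)) :
    q.form₁ (p - p') = 0 ∧ q.form₂ (p - p') = 0 := by
  have hf : q.f * (p 3 * q.sigma p' - p' 3 * q.sigma p)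
      = -(q.beta p * (q.h * (p 1 - p' 1))) := by
    simp only [beta, sigma] at hβ ⊢
    linear_combination (q.g + q.h * p 1) * hβ
  have hc : q.c * (p 3 * q.sigma p' - p' 3 * q.sigma p) = -(q.beta p * (p 3 - p' 3)) := by
    simp only [beta, sigma] at hβ ⊢
    linear_combination p 3 * hβ
  constructor
  · refine mul_left_cancel₀ h0 ?_
    simp only [form₁_apply, Pi.sub_apply, hp.affine, hp'.affine]
    linear_combination q.f * h + (p 2 - p' 2) * hf
  · refine mul_left_cancel₀ h0 ?_
    simp only [form₂_apply, Pi.sub_apply, hp.affine, hp'.affine]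
    linear_combination q.c * h + (p 2 - p' 2) * hc

theorem exists_det_eliminationMatrix_ne_zero [NeZero (2 : k)]
    (hq : PrimePencil q.form₁ q.form₂) (hp : q.OnCurve p) (hp' : q.OnCurve p')
    (hne : p 1 ≠ p' 1) : ∃ v, (q.eliminationMatrix p p' v).det ≠ 0 := by
  by_contra! hdet
  have hsq := beta_mul_beta_mul_sq_eq hdet
  have hβne := beta_ne_zero_or_beta_ne_zero hq hp hp' hne
  rcases mul_eq_zero.1 (mul_beta_sub_beta_eq_zero hdet) with hω | hβ
  · rw [hω, zero_mul] at hsq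
    rw [sub_eq_zero] at hω
    have hzero : q.beta p = 0 ∨ q.beta p' = 0 :=
      mul_eq_zero.1 ((mul_eq_zero.1 hsq).resolve_right (pow_ne_zero 2 (sub_ne_zero.2 hne)))
    have hiff : q.beta p = 0 ↔ q.beta p' = 0 :=
      ⟨beta_eq_zero_of_beta_eq_zero hq hp hω, beta_eq_zero_of_beta_eq_zero hq hp' hω.symm⟩
    tauto
  · rw [sub_eq_zero] at hβ
    have h0 : q.beta p ≠ 0 := by simpa [← hβ] using hβne
    have hsub := form₁_sub_eq_zero_and_form₂_sub_eq_zero hp hp' hβ h0 <|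
      mul_left_cancel₀ h0 (by rw [← hβ] at hsq; linear_combination hsq)
    exact (form₁_sub_ne_zero_or_form₂_sub_ne_zero hq hp hp' hne).elim (· hsub.1) (· hsub.2)

theorem exists_skewRays_targetCamera [NeZero (2 : k)] (hq : PrimePencil q.form₁ q.form₂)
    (hp : q.OnCurve p) (hp' : q.OnCurve p') (hne : p 1 ≠ p' 1) :
    ∃ v, SkewRays (q.targetCamera p) (q.targetCamera p') (sourceCamera p *ᵥ v)
      (sourceCamera p' *ᵥ v) :=
  (exists_det_eliminationMatrix_ne_zero hq hp hp' hne).imp fun _ =>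
    skewRays_of_det_eliminationMatrix_ne_zero hq hp hp' hne

end SkewRays
end QuarticCoeff

section HomogeneousPolynomials

open MvPolynomial
open scoped Pointwise

attribute [local instance] MvPolynomial.gradedAlgebra

variable {σ R : Type*} [CommRing R] {q₁ q₂ φ ψ : MvPolynomial σ R} {d m : ℕ}

theorem eq_zero_of_isHomogeneous_of_mem_span_pair (h₁ : q₁.IsHomogeneous d)
    (h₂ : q₂.IsHomogeneous d) (hφ : φ.IsHomogeneous m) (hm : m < d)
    (h : φ ∈ Ideal.span {q₁, q₂}) : φ = 0 := by
  obtain ⟨a, b, rfl⟩ := Ideal.mem_span_pair.1 h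
  rw [← DirectSum.decompose_of_mem_same (homogeneousSubmodule σ R) hφ, DirectSum.decompose_add,
    DirectSum.add_apply, Submodule.coe_add,
    DirectSum.coe_decompose_mul_of_right_mem_of_not_le _ h₁ hm.not_ge,
    DirectSum.coe_decompose_mul_of_right_mem_of_not_le _ h₂ hm.not_ge, add_zero]

theorem exists_eq_C_mul_add_C_mul_of_mem_span_pair (h₁ : q₁.IsHomogeneous d)
    (h₂ : q₂.IsHomogeneous d) (hφ : φ.IsHomogeneous d) (h : φ ∈ Ideal.span {q₁, q₂}) :
    ∃ α β : R, φ = C α * q₁ + C β * q₂ := by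
  obtain ⟨a, b, rfl⟩ := Ideal.mem_span_pair.1 h
  have eq_C (ψ : MvPolynomial σ R) :
      ∃ α, (DirectSum.decompose (homogeneousSubmodule σ R) ψ 0 : MvPolynomial σ R) = C α :=
    ⟨_, totalDegree_eq_zero_iff_eq_C.1 ((totalDegree_zero_iff_isHomogeneous _).2
      (DirectSum.decompose (homogeneousSubmodule σ R) ψ 0).2)⟩
  obtain ⟨α, hα⟩ := eq_C a
  obtain ⟨β, hβ⟩ := eq_C b
  refine ⟨α, β, ?_⟩
  rw [← hα, ← hβ]
  conv_lhs => rw [← DirectSum.decompose_of_mem_same (homogeneousSubmodule σ R) hφ,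
    DirectSum.decompose_add, DirectSum.add_apply, Submodule.coe_add,
    DirectSum.coe_decompose_mul_of_right_mem_of_le _ h₁ le_rfl,
    DirectSum.coe_decompose_mul_of_right_mem_of_le _ h₂ le_rfl, Nat.sub_self]

theorem isHomogeneous_two_induction {P : MvPolynomial σ R → Prop}
    (hX : ∀ i j, P (X i * X j)) (hzero : P 0) (hadd : ∀ φ ψ, P φ → P ψ → P (φ + ψ))
    (hsmul : ∀ (r : R) φ, P φ → P (r • φ)) (hφ : φ.IsHomogeneous 2) : P φ := by
  have hspan : φ ∈ Submodule.span R
        (Set.range (X : σ → MvPolynomial σ R) * Set.range (X : σ → MvPolynomial σ R)) := by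
    rwa [← Submodule.span_mul_span, ← homogeneousSubmodule_one_eq_span_X, ← pow_two,
      homogeneousSubmodule_one_pow]
  refine Submodule.span_induction ?_ hzero (fun φ ψ _ _ => hadd φ ψ) (fun r φ _ => hsmul r φ) hspan
  rintro _ ⟨_, ⟨i, rfl⟩, _, ⟨j, rfl⟩, rfl⟩
  exact hX i j

theorem exists_quadraticForm_apply_eq_eval (hφ : φ.IsHomogeneous 2) :
    ∃ Q : QuadraticForm R (σ → R), ∀ v, Q v = eval v φ := by
  refine isHomogeneous_two_induction (φ := φ) (P := fun φ => ∃ Q : QuadraticForm R (σ → R),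
    ∀ v, Q v = eval v φ) (fun i j => ⟨QuadraticMap.proj i j, ?_⟩) ⟨0, ?_⟩ ?_ ?_ hφ
  · simp
  · simp
  · rintro φ ψ ⟨Q, hQ⟩ ⟨Q', hQ'⟩
    exact ⟨Q + Q', fun v => by simp [hQ, hQ']⟩
  · rintro r φ ⟨Q, hQ⟩
    exact ⟨r • Q, fun v => by simp [hQ, smul_eval]⟩

theorem polar_eval_eq_sum_mul_eval_pderiv [Fintype σ] (hφ : φ.IsHomogeneous 2) (u v : σ → R) :
    QuadraticMap.polar (fun w => eval w φ) u v = ∑ i, v i * eval u (pderiv i φ) := by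
  classical
  simp only [QuadraticMap.polar]
  refine isHomogeneous_two_induction (P := fun φ => eval (u + v) φ - eval u φ - eval v φ =
    ∑ i, v i * eval u (pderiv i φ)) (fun i j => ?_) ?_ ?_ ?_ hφ
  · simp only [Derivation.leibniz, pderiv_X, Pi.single_apply, smul_eq_mul, mul_ite, mul_one,
      mul_zero, map_add, map_mul, eval_X, apply_ite (eval u), map_zero, Pi.add_apply, mul_add,
      Finset.sum_add_distrib, Finset.sum_ite_eq, Finset.mem_univ, if_true]
    ring
  · simp
  · intro φ ψ hφ hψ
    simp only [map_add, mul_add, Finset.sum_add_distrib, ← hφ, ← hψ]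
    ring
  · intro r φ hφ
    simp only [Derivation.map_smul, smul_eval, mul_left_comm _ r, ← Finset.mul_sum, ← hφ]
    ring

theorem exists_isHomogeneous_one_eval_eq [Finite σ] (a : Module.Dual R (σ → R)) :
    ∃ φ : MvPolynomial σ R, φ.IsHomogeneous 1 ∧ ∀ v, eval v φ = a v := by
  classical
  have := Fintype.ofFinite σ
  refine ⟨∑ i, C (a fun j => if i = j then 1 else 0) * X i,
    .sum _ _ _ fun i _ => isHomogeneous_C_mul_X _ i, fun v => ?_⟩
  rw [LinearMap.pi_apply_eq_sum_univ a v]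
  simp [mul_comm]

theorem exists_isHomogeneous_two_eval_eq [Finite σ]
    (Q : QuadraticForm R (σ → R)) :
    ∃ φ : MvPolynomial σ R, φ.IsHomogeneous 2 ∧ ∀ v, eval v φ = Q v := by
  classical
  have := Fintype.ofFinite σ
  obtain ⟨B, rfl⟩ := LinearMap.BilinMap.toQuadraticMap_surjective Q
  refine ⟨∑ i, ∑ j, C (LinearMap.BilinForm.toMatrix' B i j) * (X i * X j),
    .sum _ _ _ fun i _ => .sum _ _ _ fun j _ =>
      ((isHomogeneous_X _ i).mul (isHomogeneous_X _ j)).C_mul _, fun v => ?_⟩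
  conv_rhs => rw [LinearMap.BilinMap.toQuadraticMap_apply, ← Matrix.toBilin'_toMatrix' B,
    Matrix.toBilin'_apply]
  simp only [map_sum, map_mul, eval_C, eval_X]
  exact Finset.sum_congr rfl fun i _ => Finset.sum_congr rfl fun j _ => by ring

end HomogeneousPolynomials

section RealPencil

open MvPolynomial

theorem isSmoothZero_of_linearIndependent_pderiv {σ K : Type*} [Finite σ] [Field K]
    {q₁ q₂ : MvPolynomial σ K} {Q₁ Q₂ : QuadraticForm K (σ → K)} {p : σ → K}
    (hq₁ : q₁.IsHomogeneous 2) (hq₂ : q₂.IsHomogeneous 2) (hQ₁ : ∀ v, Q₁ v = eval v q₁)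
    (hQ₂ : ∀ v, Q₂ v = eval v q₂) (h₁ : eval p q₁ = 0) (h₂ : eval p q₂ = 0)
    (h : LinearIndependent K
      ![fun i => eval p (pderiv i q₁), fun i => eval p (pderiv i q₂)]) :
    IsSmoothZero Q₁ Q₂ p where
  zero_left := by rw [hQ₁, h₁]
  zero_right := by rw [hQ₂, h₂]
  linearIndependent := LinearIndependent.pair_iff.2 fun α β hαβ => by
    classical
    have := Fintype.ofFinite σ
    have polarBilin_single {q : MvPolynomial σ K} {Q : QuadraticForm K (σ → K)}
        (hq : q.IsHomogeneous 2) (hQ : ∀ v, Q v = eval v q) (i : σ) :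
        Q.polarBilin p (Pi.single i 1) = eval p (pderiv i q) := by
      rw [QuadraticMap.polarBilin_apply_apply, funext hQ, polar_eval_eq_sum_mul_eval_pderiv hq]
      simp [Pi.single_apply]
    refine LinearIndependent.pair_iff.1 h α β (funext fun i => ?_)
    simpa [polarBilin_single hq₁ hQ₁, polarBilin_single hq₂ hQ₂] using
      LinearMap.congr_fun hαβ (Pi.single i 1)

variable {q₁ q₂ : MvPolynomial (Fin 4) ℝ}

namespace IsIrreducibleQuartic

theorem eq_zero_of_map_mem_span (h : IsIrreducibleQuartic q₁ q₂) {a : Module.Dual ℝ (Fin 4 → ℝ)}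
    {φ : MvPolynomial (Fin 4) ℝ} (hφ : φ.IsHomogeneous 1) (ha : ∀ v, eval v φ = a v)
    (hmem : map (algebraMap ℝ ℂ) φ ∈
      Ideal.span {map (algebraMap ℝ ℂ) q₁, map (algebraMap ℝ ℂ) q₂}) : a = 0 := by
  have h0 : φ = 0 := map_injective _ (algebraMap ℝ ℂ).injective <| by
    rw [map_zero, eq_zero_of_isHomogeneous_of_mem_span_pair (h.homogeneous_left.map _)
      (h.homogeneous_right.map _) (hφ.map _) one_lt_two hmem]
  exact LinearMap.ext fun v => by rw [← ha, h0, map_zero, LinearMap.zero_apply]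

theorem exists_eq_smul_add_smul_of_map_mem_span (h : IsIrreducibleQuartic q₁ q₂)
    {Q₁ Q₂ S : QuadraticForm ℝ (Fin 4 → ℝ)} (hQ₁ : ∀ v, Q₁ v = eval v q₁)
    (hQ₂ : ∀ v, Q₂ v = eval v q₂) {φ : MvPolynomial (Fin 4) ℝ} (hφ : φ.IsHomogeneous 2)
    (hS : ∀ v, eval v φ = S v) (hmem : map (algebraMap ℝ ℂ) φ ∈
      Ideal.span {map (algebraMap ℝ ℂ) q₁, map (algebraMap ℝ ℂ) q₂}) :
    ∃ α β : ℝ, S = α • Q₁ + β • Q₂ := by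
  obtain ⟨α, β, hαβ⟩ := exists_eq_C_mul_add_C_mul_of_mem_span_pair (h.homogeneous_left.map _)
    (h.homogeneous_right.map _) (hφ.map _) hmem
  refine ⟨α.re, β.re, QuadraticMap.ext fun v => ?_⟩
  have eval_map_ofReal (ψ : MvPolynomial (Fin 4) ℝ) :
      eval (algebraMap ℝ ℂ ∘ v) (map (algebraMap ℝ ℂ) ψ) = (eval v ψ : ℝ) := by
    rw [eval_map, ← eval₂_comp]
    rfl
  have hv := congrArg (eval (algebraMap ℝ ℂ ∘ v)) hαβ
  rw [map_add, map_mul, map_mul, eval_map_ofReal, eval_map_ofReal, eval_map_ofReal, eval_C, eval_C,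
    hS, ← hQ₁, ← hQ₂] at hv
  simpa using congrArg Complex.re hv

theorem primePencil (h : IsIrreducibleQuartic q₁ q₂) {Q₁ Q₂ : QuadraticForm ℝ (Fin 4 → ℝ)}
    (hQ₁ : ∀ v, Q₁ v = eval v q₁) (hQ₂ : ∀ v, Q₂ v = eval v q₂) : PrimePencil Q₁ Q₂ where
  linearIndependent := LinearIndependent.pair_iff.2 fun α β hαβ =>
    LinearIndependent.pair_iff.1 h.linearIndependent α β <| MvPolynomial.funext fun v => by
      simpa [hQ₁, hQ₂, smul_eval] using QuadraticMap.congr_fun hαβ v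
  irred α β a b hab := by
    obtain ⟨φ, hφ, hφa⟩ := exists_isHomogeneous_one_eval_eq a
    obtain ⟨ψ, hψ, hψb⟩ := exists_isHomogeneous_one_eval_eq b
    have hprod : φ * ψ = C α * q₁ + C β * q₂ := MvPolynomial.funext fun v => by
      simpa [hφa, hψb, hQ₁, hQ₂] using QuadraticMap.congr_fun hab v
    refine (h.isPrime.mem_or_mem ?_).imp (h.eq_zero_of_map_mem_span hφ hφa)
      (h.eq_zero_of_map_mem_span hψ hψb)
    rw [← map_mul, hprod, map_add, map_mul, map_mul]
    exact Ideal.mem_span_pair.2 ⟨_, _, rfl⟩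
  prime a m₁ m₂ S hS := by
    obtain ⟨φ, hφ, hφa⟩ := exists_isHomogeneous_one_eval_eq a
    obtain ⟨ψ, hψ, hψS⟩ := exists_isHomogeneous_two_eval_eq S
    obtain ⟨μ₁, -, hμ₁⟩ := exists_isHomogeneous_one_eval_eq m₁
    obtain ⟨μ₂, -, hμ₂⟩ := exists_isHomogeneous_one_eval_eq m₂
    have hprod : φ * ψ = μ₁ * q₁ + μ₂ * q₂ := MvPolynomial.funext fun v => by
      simpa [hφa, hψS, hμ₁, hμ₂, hQ₁, hQ₂] using hS v
    refine (h.isPrime.mem_or_mem ?_).imp (h.eq_zero_of_map_mem_span hφ hφa)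
      (h.exists_eq_smul_add_smul_of_map_mem_span hQ₁ hQ₂ hψ hψS)
    rw [← map_mul, hprod, map_add, map_mul, map_mul]
    exact Ideal.mem_span_pair.2 ⟨_, _, rfl⟩

end IsIrreducibleQuartic
end RealPencil

section RealPoints

theorem exists_isRoot_of_odd_natDegree {p : Polynomial ℝ} (hp : Odd p.natDegree) :
    ∃ x, p.IsRoot x := by
  wlog hlc : 0 < p.leadingCoeff generalizing p
  · have hp₀ : p ≠ 0 := fun h => by simp [h] at hp
    obtain ⟨x, hx⟩ := this (p := -p) (by rwa [Polynomial.natDegree_neg]) (by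
      rw [Polynomial.leadingCoeff_neg, neg_pos]
      exact lt_of_le_of_ne (not_lt.1 hlc) (Polynomial.leadingCoeff_ne_zero.2 hp₀))
    exact ⟨x, by simpa using hx⟩
  have hdeg : 0 < p.degree := Polynomial.natDegree_pos_iff_degree_pos.1 hp.pos
  refine p.continuous.surjective (p.tendsto_atTop_of_leadingCoeff_nonneg hdeg hlc.le) ?_ 0
  have hbot : Filter.Tendsto (fun x => (p.comp (-Polynomial.X)).eval x) .atTop .atBot := by
    refine Polynomial.tendsto_atBot_of_leadingCoeff_nonpos _ ?_ ?_
    · rw [← Polynomial.natDegree_pos_iff_degree_pos, Polynomial.natDegree_comp,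
        Polynomial.natDegree_neg, Polynomial.natDegree_X, mul_one]
      exact hp.pos
    · rw [Polynomial.leadingCoeff_comp (by simp)]
      simp [hp.neg_one_pow, hlc.le]
  simpa [Function.comp_def] using hbot.comp Filter.tendsto_neg_atBot_atTop

theorem exists_forall_eval_ne_zero {σ R ι : Type*} [CommRing R] [IsDomain R] [Infinite R]
    {s : Finset ι} {f : ι → MvPolynomial σ R} (hf : ∀ i ∈ s, f i ≠ 0) :
    ∃ u, ∀ i ∈ s, MvPolynomial.eval u (f i) ≠ 0 := by
  by_contra! h
  refine Finset.prod_ne_zero_iff.2 hf (MvPolynomial.funext fun u => ?_)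
  obtain ⟨i, hi, hu⟩ := h u
  rw [map_prod, Finset.prod_eq_zero hi hu, map_zero]

theorem exists_eval_eq_projectionCubic {σ R : Type*} [Field R] [Finite σ]
    (Q₁ Q₂ : QuadraticForm R (σ → R)) (p : σ → R) :
    ∃ φ : MvPolynomial σ R, ∀ v, MvPolynomial.eval v φ = projectionCubic Q₁ Q₂ p v := by
  obtain ⟨a₁, -, ha₁⟩ := exists_isHomogeneous_one_eval_eq (Q₁.polarBilin p)
  obtain ⟨a₂, -, ha₂⟩ := exists_isHomogeneous_one_eval_eq (Q₂.polarBilin p)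
  obtain ⟨b₁, -, hb₁⟩ := exists_isHomogeneous_two_eval_eq Q₁
  obtain ⟨b₂, -, hb₂⟩ := exists_isHomogeneous_two_eval_eq Q₂
  exact ⟨a₁ * b₂ - a₂ * b₁, fun v => by simp [projectionCubic, ha₁, ha₂, hb₁, hb₂]⟩

theorem exists_projectionCubic_add_smul_eq_zero {V : Type*} [AddCommGroup V] [Module ℝ V]
    {Q₁ Q₂ : QuadraticForm ℝ V} {p w : V} (hw : projectionCubic Q₁ Q₂ p w ≠ 0) (u : V) :
    ∃ x : ℝ, projectionCubic Q₁ Q₂ p (u + x • w) = 0 := by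
  set X := Q₁.polarBilin p
  set Z := Q₂.polarBilin p
  obtain ⟨x, hx⟩ := exists_isRoot_of_odd_natDegree (p := Cubic.toPoly
    ⟨projectionCubic Q₁ Q₂ p w,
      X u * Q₂ w + X w * Q₂.polarBilin u w - Z u * Q₁ w - Z w * Q₁.polarBilin u w,
      X u * Q₂.polarBilin u w + X w * Q₂ u - Z u * Q₁.polarBilin u w - Z w * Q₁ u,
      projectionCubic Q₁ Q₂ p u⟩) (by
      rw [Cubic.natDegree_of_a_ne_zero hw]
      decide)
  refine ⟨x, ?_⟩
  rw [← hx.eq_zero, projectionCubic, QuadraticMap.map_add Q₁, QuadraticMap.map_add Q₂]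
  simp only [projectionCubic, Cubic.toPoly, Polynomial.eval_add, Polynomial.eval_mul,
    Polynomial.eval_C, Polynomial.eval_pow, Polynomial.eval_X, map_add, map_smul,
    QuadraticMap.map_smul, QuadraticMap.polar_smul_right, QuadraticMap.polarBilin_apply_apply,
    smul_eq_mul, X, Z]
  ring

theorem exists_add_smul_eq_zero_of_projectionCubic_eq_zero {K V : Type*} [Field K]
    [AddCommGroup V] [Module K V] {Q₁ Q₂ : QuadraticForm K V} {p v : V}
    (hp : IsSmoothZero Q₁ Q₂ p) (hv : Q₁.polarBilin p v ≠ 0)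
    (hF : projectionCubic Q₁ Q₂ p v = 0) : ∃ t : K, Q₁ (v + t • p) = 0 ∧ Q₂ (v + t • p) = 0 := by
  have map_add_smul {Q : QuadraticForm K V} (hQ : Q p = 0) (t : K) :
      Q (v + t • p) = Q v + t * Q.polarBilin p v := by
    rw [QuadraticMap.map_add Q, QuadraticMap.map_smul, hQ, QuadraticMap.polar_smul_right,
      QuadraticMap.polar_comm, QuadraticMap.polarBilin_apply_apply]
    simp
  refine ⟨-Q₁ v / Q₁.polarBilin p v, ?_, ?_⟩
  · rw [map_add_smul hp.zero_left]
    field_simp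
    ring
  · rw [map_add_smul hp.zero_right]
    rw [projectionCubic] at hF
    field_simp
    linear_combination hF

theorem PrimePencil.exists_eval_ne_zero_and_forall {K σ : Type*} [Field K] [Infinite K]
    [NeZero (2 : K)] [Finite σ] {Q₁ Q₂ : QuadraticForm K (σ → K)} {p : σ → K}
    (hQ : PrimePencil Q₁ Q₂) (hp : IsSmoothZero Q₁ Q₂ p) {a : Module.Dual K (σ → K)} (ha : a ≠ 0)
    (hap : a p = 0) (w : σ → K) :
    ∃ φ : MvPolynomial σ K, φ ≠ 0 ∧ ∀ u, MvPolynomial.eval u φ ≠ 0 →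
      ∀ x : K, projectionCubic Q₁ Q₂ p (u + x • w) = 0 → a (u + x • w) ≠ 0 := by
  by_cases haw : a w = 0
  · obtain ⟨φ, -, hφ⟩ := exists_isHomogeneous_one_eval_eq a
    refine ⟨φ, fun h => ha (LinearMap.ext fun v => by simp [← hφ, h]), fun u hu x _ => ?_⟩
    rwa [map_add, map_smul, haw, smul_zero, add_zero, ← hφ]
  set π : (σ → K) →ₗ[K] (σ → K) := LinearMap.id - (a.smulRight ((a w)⁻¹ • w)) with hπ
  have hπu (u : σ → K) : π u = u - (a u / a w) • w := by
    simp [hπ, smul_smul, div_eq_mul_inv]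
  have hπp : π p = p := by simp [hπu, hap]
  obtain ⟨φ, hφ⟩ := exists_eval_eq_projectionCubic (Q₁.comp π) (Q₂.comp π) p
  have hφπ (u : σ → K) : MvPolynomial.eval u φ = projectionCubic Q₁ Q₂ p (π u) := by
    rw [hφ]
    simp [projectionCubic, QuadraticMap.polar, hπp]
  refine ⟨φ, ?_, fun u hu x hx hax => hu ?_⟩
  · rintro rfl
    obtain ⟨v, hav, hFv⟩ := hQ.exists_projectionCubic_ne_zero hp ha hap
    refine hFv ?_
    rw [← map_zero (MvPolynomial.eval v), hφπ, hπu, hav, zero_div, zero_smul, sub_zero]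
  · have hx' : x = -(a u / a w) := by
      rw [map_add, map_smul, smul_eq_mul] at hax
      field_simp
      linear_combination hax
    rw [hφπ, hπu, ← hx, hx', neg_smul, sub_eq_add_neg]

theorem PrimePencil.exists_zero_forall_ne_zero {σ : Type*} [Finite σ]
    {Q₁ Q₂ : QuadraticForm ℝ (σ → ℝ)} {p : σ → ℝ} (hQ : PrimePencil Q₁ Q₂)
    (hp : IsSmoothZero Q₁ Q₂ p) (Λ : Finset (Module.Dual ℝ (σ → ℝ))) (hΛ : ∀ a ∈ Λ, a p = 0) :
    ∃ v, Q₁ v = 0 ∧ Q₂ v = 0 ∧ ∀ a ∈ Λ, a ≠ 0 → a v ≠ 0 := by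
  classical
  set X := Q₁.polarBilin p
  have hX₀ : X ≠ 0 := hp.linearIndependent.ne_zero 0
  have hXp : X p = 0 := polarBilin_self_of_apply_eq_zero hp.zero_left
  obtain ⟨w, -, hw⟩ := hQ.exists_projectionCubic_ne_zero hp hX₀ hXp
  have hΛX : ∀ a ∈ insert X Λ, a p = 0 := Finset.forall_mem_insert _ _ _ |>.2 ⟨hXp, hΛ⟩
  choose! f hf₀ hf using fun (a : Module.Dual ℝ (σ → ℝ)) (ha : a ∈ insert X Λ ∧ a ≠ 0) =>
    hQ.exists_eval_ne_zero_and_forall hp ha.2 (hΛX a ha.1) w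
  obtain ⟨u, hu⟩ := exists_forall_eval_ne_zero (s := (insert X Λ).filter (· ≠ 0)) (f := f)
    fun a ha => hf₀ a (Finset.mem_filter.1 ha)
  obtain ⟨x, hx⟩ := exists_projectionCubic_add_smul_eq_zero hw u
  have hne : ∀ a ∈ insert X Λ, a ≠ 0 → a (u + x • w) ≠ 0 := fun a ha ha₀ =>
    hf a ⟨ha, ha₀⟩ u (hu a (Finset.mem_filter.2 ⟨ha, ha₀⟩)) x hx
  obtain ⟨t, ht₁, ht₂⟩ := exists_add_smul_eq_zero_of_projectionCubic_eq_zero hp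
    (hne X (Finset.mem_insert_self _ _) hX₀) hx
  refine ⟨u + x • w + t • p, ht₁, ht₂, fun a ha ha₀ => ?_⟩
  rw [map_add, map_smul, hΛ a ha, smul_zero, add_zero]
  exact hne a (Finset.mem_insert_of_mem ha) ha₀

end RealPoints

section NormalForm

open QuadraticMap

variable {K V : Type*} [Field K] [AddCommGroup V] [Module K V]

/-- Linear coordinates on `V`, together with a new basis `s • Q₁ + t • Q₂`, `r • Q₂` of the pencil
of `Q₁` and `Q₂`, that bring the pencil into normal form. -/
structure NormalForm (Q₁ Q₂ : QuadraticForm K V) where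
  coeff : QuarticCoeff K
  e : (Fin 4 → K) ≃ₗ[K] V
  (s t r : K)
  s_ne_zero : s ≠ 0
  r_ne_zero : r ≠ 0
  form₁_eq : coeff.form₁ = (s • Q₁ + t • Q₂).comp e.toLinearMap
  form₂_eq : coeff.form₂ = (r • Q₂).comp e.toLinearMap

variable {Q₁ Q₂ A B : QuadraticForm K V} {o p v : V}

theorem exists_polarBilin_eq_one_and_eq_zero (hBp : B p = 0) (hAp : A p = 0) (hBo : B o = 0)
    (hA : A.polarBilin p ≠ 0) (hAop : A.polarBilin p o = 0) (hBop : B.polarBilin p o = 1) :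
    ∃ x, A.polarBilin p x = 1 ∧ B.polarBilin p x = 0 ∧ B.polarBilin o x = 0 := by
  have hBpo : B.polarBilin o p = 1 := by
    rwa [polarBilin_apply_apply, polar_comm, ← polarBilin_apply_apply]
  have hApp := polarBilin_self_of_apply_eq_zero hAp
  have hBpp := polarBilin_self_of_apply_eq_zero hBp
  have hBoo := polarBilin_self_of_apply_eq_zero hBo
  obtain ⟨x₀, hx₀⟩ := LinearMap.surjective hA 1
  refine ⟨x₀ - B.polarBilin p x₀ • o - B.polarBilin o x₀ • p, ?_, ?_, ?_⟩ <;>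
    simp only [map_sub, map_smul, hx₀, hAop, hBop, hBpo, hApp, hBpp, hBoo, smul_eq_mul, mul_one,
      mul_zero, sub_zero, sub_self]

/-- The coordinate vectors are `x, y, o, p`, where `y` spans the intersection of the three planes
`dA(p) = 0`, `dB(p) = 0`, `dB(o) = 0`, and `x` lies on the last two of them. -/
theorem exists_basis_of_polarBilin (hV : Module.finrank K V = 4) (hBp : B p = 0) (hAp : A p = 0)
    (hBo : B o = 0) (hA : A.polarBilin p ≠ 0) (hAop : A.polarBilin p o = 0)
    (hBop : B.polarBilin p o = 1) :
    ∃ (x y : V) (e : (Fin 4 → K) ≃ₗ[K] V),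
      (∀ v, e v = v 0 • x + v 1 • y + v 2 • o + v 3 • p) ∧
        (A.polarBilin p x = 1 ∧ B.polarBilin p x = 0 ∧ B.polarBilin o x = 0) ∧
        A.polarBilin p y = 0 ∧ B.polarBilin p y = 0 ∧ B.polarBilin o y = 0 := by
  have hBpo : B.polarBilin o p = 1 := by
    rwa [polarBilin_apply_apply, polar_comm, ← polarBilin_apply_apply]
  have hApp := polarBilin_self_of_apply_eq_zero hAp
  have hBpp := polarBilin_self_of_apply_eq_zero hBp
  have hBoo := polarBilin_self_of_apply_eq_zero hBo
  obtain ⟨x, hxA, hxB, hxBo⟩ := exists_polarBilin_eq_one_and_eq_zero hBp hAp hBo hA hAop hBop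
  have : FiniteDimensional K V := FiniteDimensional.of_finrank_eq_succ hV
  obtain ⟨y, hy, hy₀⟩ := Submodule.exists_mem_ne_zero_of_ne_bot
    (LinearMap.ker_ne_bot_of_finrank_lt
      (f := LinearMap.pi ![A.polarBilin p, B.polarBilin p, B.polarBilin o]) (by simp [hV]))
  have hyA : A.polarBilin p y = 0 := congrFun hy 0
  have hyB : B.polarBilin p y = 0 := congrFun hy 1
  have hyBo : B.polarBilin o y = 0 := congrFun hy 2
  have hli : LinearIndependent K ![x, y, o, p] := by
    refine Fintype.linearIndependent_iff.2 fun g hg => ?_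
    simp only [Fin.sum_univ_four, Matrix.cons_val] at hg
    have h₀ : g 0 = 0 := by
      simpa only [map_add, map_smul, map_zero, hxA, hyA, hAop, hApp, smul_eq_mul,
        mul_one, mul_zero, add_zero] using congrArg (A.polarBilin p) hg
    have h₂ : g 2 = 0 := by
      simpa only [map_add, map_smul, map_zero, hxB, hyB, hBop, hBpp, smul_eq_mul,
        mul_one, mul_zero, add_zero, zero_add] using congrArg (B.polarBilin p) hg
    have h₃ : g 3 = 0 := by
      simpa only [map_add, map_smul, map_zero, hxBo, hyBo, hBoo, hBpo, smul_eq_mul,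
        mul_one, mul_zero, zero_add] using congrArg (B.polarBilin o) hg
    have h₁ : g 1 = 0 := by simpa [h₀, h₂, h₃, hy₀] using hg
    intro i
    fin_cases i
    exacts [h₀, h₁, h₂, h₃]
  refine ⟨x, y, (basisOfLinearIndependentOfCardEqFinrank hli (by simp [hV])).equivFun.symm,
    fun v => ?_, ⟨hxA, hxB, hxBo⟩, hyA, hyB, hyBo⟩
  simp [Module.Basis.equivFun_symm_apply, Fin.sum_univ_four]

theorem exists_form_eq_comp (hV : Module.finrank K V = 4) (hAp : A p = 0) (hBp : B p = 0)
    (hAo : A o = 0) (hBo : B o = 0) (hA : A.polarBilin p ≠ 0) (hAop : A.polarBilin p o = 0)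
    (hBop : B.polarBilin p o = 1) :
    ∃ (q : QuarticCoeff K) (e : (Fin 4 → K) ≃ₗ[K] V), q.form₁ = A.comp e.toLinearMap ∧
      q.form₂ = B.comp e.toLinearMap ∧ e ![0, 0, 1, 0] = o ∧ e ![0, 0, 0, 1] = p := by
  obtain ⟨x, y, e, he, ⟨hxA, hxB, hxBo⟩, hyA, hyB, hyBo⟩ :=
    exists_basis_of_polarBilin hV hBp hAp hBo hA hAop hBop
  simp only [polarBilin_apply_apply] at hxA hxB hxBo hyA hyB hyBo hAop hBop
  have apply_e (Q : QuadraticForm K V) (hp : Q p = 0) (ho : Q o = 0) (v : Fin 4 → K) :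
      Q (e v) = v 0 ^ 2 * Q x + v 0 * v 1 * polar Q x y + v 1 ^ 2 * Q y
        + v 0 * v 2 * polar Q o x + v 1 * v 2 * polar Q o y + v 0 * v 3 * polar Q p x
        + v 1 * v 3 * polar Q p y + v 2 * v 3 * polar Q p o := by
    simp only [he, QuadraticMap.map_add Q, QuadraticMap.map_smul, polar_add_left, polar_smul_left,
      polar_smul_right, hp, ho, smul_eq_mul, polar_comm Q x o, polar_comm Q x p,
      polar_comm Q y o, polar_comm Q y p, polar_comm Q o p]
    ring
  refine ⟨⟨B x, polar B x y, B y, A x, polar A x y, A y, polar A o x, polar A o y⟩, e,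
    ext fun v => ?_, ext fun v => ?_, by simp [he], by simp [he]⟩
  · rw [QuarticCoeff.form₁_apply, comp_apply, LinearEquiv.coe_coe, apply_e A hAp hAo, hxA, hyA,
      hAop]
    ring
  · rw [QuarticCoeff.form₂_apply, comp_apply, LinearEquiv.coe_coe, apply_e B hBp hBo, hxB, hxBo,
      hyB, hyBo, hBop]
    ring

theorem IsSmoothZero.exists_normalForm (hp : IsSmoothZero Q₁ Q₂ p)
    (hV : Module.finrank K V = 4) (h₁ : Q₁ o = 0) (h₂ : Q₂ o = 0)
    (ho : Q₂.polarBilin p o ≠ 0) :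
    ∃ N : NormalForm Q₁ Q₂, N.e ![0, 0, 1, 0] = o ∧ N.e ![0, 0, 0, 1] = p := by
  set s := Q₂.polarBilin p o with hs
  set t := -Q₁.polarBilin p o with ht
  have polarBilin_pencil (α β : K) (v : V) : (α • Q₁ + β • Q₂).polarBilin p v =
      α * Q₁.polarBilin p v + β * Q₂.polarBilin p v := by
    simp only [polarBilin_apply_apply, polar, add_apply, smul_apply, smul_eq_mul]
    ring
  have hA : (s • Q₁ + t • Q₂).polarBilin p ≠ 0 := fun h =>
    ho (LinearIndependent.pair_iff.1 hp.linearIndependent s t (LinearMap.ext fun v => by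
      simpa [polarBilin_pencil] using LinearMap.congr_fun h v)).1
  obtain ⟨q, e, hq₁, hq₂, heo, hep⟩ := exists_form_eq_comp (A := s • Q₁ + t • Q₂)
    (B := s⁻¹ • Q₂) (o := o) (p := p) hV (by simp [hp.zero_left, hp.zero_right])
    (by simp [hp.zero_right]) (by simp [h₁, h₂]) (by simp [h₂]) hA
    (by rw [polarBilin_pencil, ← hs, ht]; ring)
    (by simpa [polarBilin_pencil, ← hs, ho] using polarBilin_pencil 0 s⁻¹ o)
  exact ⟨⟨q, e, s, t, s⁻¹, ho, inv_ne_zero ho, hq₁, hq₂⟩, heo, hep⟩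

namespace NormalForm

theorem primePencil (N : NormalForm Q₁ Q₂) (h : PrimePencil Q₁ Q₂) :
    PrimePencil N.coeff.form₁ N.coeff.form₂ := by
  rw [N.form₁_eq, N.form₂_eq]
  exact (h.change N.s_ne_zero N.r_ne_zero N.t).comp N.e

theorem form₁_symm_eq_zero (N : NormalForm Q₁ Q₂) (h₁ : Q₁ v = 0) (h₂ : Q₂ v = 0) :
    N.coeff.form₁ (N.e.symm v) = 0 := by
  simp [N.form₁_eq, h₁, h₂]

theorem form₂_symm_eq_zero (N : NormalForm Q₁ Q₂) (h₂ : Q₂ v = 0) :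
    N.coeff.form₂ (N.e.symm v) = 0 := by
  simp [N.form₂_eq, h₂]

theorem symm_zero_eq (N : NormalForm Q₁ Q₂) (v : V) :
    N.e.symm v 0 = N.s * Q₁.polarBilin (N.e ![0, 0, 0, 1]) v
      + N.t * Q₂.polarBilin (N.e ![0, 0, 0, 1]) v := by
  rw [← N.coeff.polarBilin_form₁_apex (N.e.symm v), N.form₁_eq]
  simp only [polarBilin_apply_apply, polar, comp_apply, map_add, LinearEquiv.coe_coe,
    LinearEquiv.apply_symm_apply, add_apply, smul_apply, smul_eq_mul]
  ring

theorem symm_two_eq (N : NormalForm Q₁ Q₂) (v : V) :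
    N.e.symm v 2 = N.r * Q₂.polarBilin (N.e ![0, 0, 0, 1]) v := by
  rw [← N.coeff.polarBilin_form₂_apex (N.e.symm v), N.form₂_eq]
  simp only [polarBilin_apply_apply, polar, comp_apply, map_add, LinearEquiv.coe_coe,
    LinearEquiv.apply_symm_apply, smul_apply, smul_eq_mul]
  ring

end NormalForm
end NormalForm

section PointsOfNormalForm

theorem QuarticCoeff.eq_smul_apex_of_form_eq_zero {k : Type*} [Field k] {q : QuarticCoeff k}
    (hq : PrimePencil q.form₁ q.form₂) {v : Fin 4 → k} (h₁ : q.form₁ v = 0) (h₂ : q.form₂ v = 0)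
    (hv₀ : v 0 = 0) (hv₂ : v 2 = 0) : v = v 3 • ![0, 0, 0, 1] := by
  have hv₁ : v 1 = 0 := by
    rw [form₁_apply, hv₀, hv₂] at h₁
    rw [form₂_apply, hv₀, hv₂] at h₂
    rcases c_ne_zero_or_f_ne_zero hq with hc | hf
    · simpa [hc] using h₂
    · simpa [hf] using h₁
  ext i
  fin_cases i <;> simp [hv₀, hv₁, hv₂]

variable {K V : Type*} [Field K] [AddCommGroup V] [Module K V] {Q₁ Q₂ : QuadraticForm K V} {c : V}

/-- The plane spanned by the tangent line of the curve `Q₁ = Q₂ = 0` at `p` and the point `c`. The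
linear form vanishes when `c` lies on the tangent line. -/
def tangentPlane (Q₁ Q₂ : QuadraticForm K V) (p c : V) : Module.Dual K V :=
  Q₁.polarBilin p c • Q₂.polarBilin p - Q₂.polarBilin p c • Q₁.polarBilin p

namespace NormalForm

theorem symm_zero_ne_zero (N : NormalForm Q₁ Q₂) (hQ : PrimePencil Q₁ Q₂)
    (hp : IsSmoothZero Q₁ Q₂ (N.e ![0, 0, 0, 1])) (h₁ : Q₁ c = 0) (h₂ : Q₂ c = 0)
    (hc : LinearIndependent K ![N.e ![0, 0, 0, 1], c])
    (ho : tangentPlane Q₁ Q₂ (N.e ![0, 0, 0, 1]) c ≠ 0 →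
      tangentPlane Q₁ Q₂ (N.e ![0, 0, 0, 1]) c (N.e ![0, 0, 1, 0]) ≠ 0) :
    N.e.symm c 0 ≠ 0 := by
  intro h₀
  have hc₀ := N.symm_zero_eq c
  have ho₀ := N.symm_zero_eq (N.e ![0, 0, 1, 0])
  have hc₂ := N.symm_two_eq c
  set p := N.e ![0, 0, 0, 1]
  set o := N.e ![0, 0, 1, 0]
  simp only [h₀, o, LinearEquiv.symm_apply_apply, Matrix.cons_val] at hc₀ ho₀
  have htangent : tangentPlane Q₁ Q₂ p c = 0 :=
    not_not.1 fun h => ho h <| mul_left_cancel₀ N.s_ne_zero <| by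
      simp only [tangentPlane, LinearMap.sub_apply, LinearMap.smul_apply, smul_eq_mul]
      linear_combination Q₂.polarBilin p c * ho₀ - Q₂.polarBilin p o * hc₀
  have hZc : Q₂.polarBilin p c = 0 := neg_eq_zero.1 (LinearIndependent.pair_iff.1
    hp.linearIndependent _ _ (by rw [← htangent, tangentPlane, neg_smul, neg_add_eq_sub])).1
  have hcp := congrArg N.e (QuarticCoeff.eq_smul_apex_of_form_eq_zero (N.primePencil hQ)
    (N.form₁_symm_eq_zero h₁ h₂) (N.form₂_symm_eq_zero h₂) h₀ (by rw [hc₂, hZc, mul_zero]))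
  rw [LinearEquiv.apply_symm_apply, map_smul] at hcp
  refine one_ne_zero (LinearIndependent.pair_iff.1 hc (-N.e.symm c 3) 1 ?_).2
  rw [one_smul, neg_smul, neg_add_eq_zero]
  exact hcp.symm

theorem exists_onCurve_apply_eq_smul (N : NormalForm Q₁ Q₂) (h₁ : Q₁ c = 0) (h₂ : Q₂ c = 0)
    (hc : N.e.symm c 0 ≠ 0) : ∃ ξ, N.coeff.OnCurve ξ ∧ ∃ a : K, a ≠ 0 ∧ N.e ξ = a • c := by
  refine ⟨(N.e.symm c 0)⁻¹ • N.e.symm c, ⟨inv_mul_cancel₀ hc, ?_, ?_⟩, _, inv_ne_zero hc, ?_⟩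
  · rw [QuadraticMap.map_smul, N.form₁_symm_eq_zero h₁ h₂, smul_zero]
  · rw [QuadraticMap.map_smul, N.form₂_symm_eq_zero h₂, smul_zero]
  · rw [map_smul, LinearEquiv.apply_symm_apply]

/-- If `ξ 1 = ξ' 1`, the plane `μ = 0` through `p`, `ξ` and `ξ'` contains `o`, unless `ξ = ξ'`. -/
theorem one_ne_one_of_onCurve (N : NormalForm Q₁ Q₂) {ξ ξ' : Fin 4 → K} (hξ : N.coeff.OnCurve ξ)
    (hξ' : N.coeff.OnCurve ξ') (hne : ξ ≠ ξ') {μ : Module.Dual K V}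
    (hμp : μ (N.e ![0, 0, 0, 1]) = 0) (hμξ : μ (N.e ξ) = 0) (hμξ' : μ (N.e ξ') = 0)
    (hμo : μ (N.e ![0, 0, 1, 0]) ≠ 0) : ξ 1 ≠ ξ' 1 := by
  intro h₁
  have hsub : ξ - ξ' = (ξ 2 - ξ' 2) • ![0, 0, 1, 0] + (ξ 3 - ξ' 3) • ![0, 0, 0, 1] := by
    ext i
    fin_cases i <;> simp [h₁, hξ.affine, hξ'.affine]
  have h₂ : ξ 2 = ξ' 2 := by
    have h := congrArg (fun v => μ (N.e v)) hsub
    simp only [map_sub, map_add, map_smul, hμp, hμξ, hμξ', smul_eq_mul, mul_zero,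
      sub_zero, add_zero] at h
    exact sub_eq_zero.1 ((mul_eq_zero.1 h.symm).resolve_right hμo)
  have h₃ : ξ 3 = ξ' 3 := by
    have hd := hξ.d_eq
    rw [hξ'.d_eq, QuarticCoeff.sigma, QuarticCoeff.sigma, h₁, h₂] at hd
    linear_combination hd
  exact hne (sub_eq_zero.1 (by rw [hsub, h₂, h₃]; simp))

end NormalForm

theorem exists_dual_ne_zero_of_three {K : Type*} [Field K] (u v w : Fin 4 → K) :
    ∃ μ : Module.Dual K (Fin 4 → K), μ ≠ 0 ∧ μ u = 0 ∧ μ v = 0 ∧ μ w = 0 := by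
  obtain ⟨μ, hμ, hμ₀⟩ := Submodule.exists_mem_ne_zero_of_ne_bot
    (LinearMap.ker_ne_bot_of_finrank_lt (f := LinearMap.pi ![Module.Dual.eval K _ u,
      Module.Dual.eval K _ v, Module.Dual.eval K _ w]) (by simp))
  exact ⟨μ, hμ₀, congrFun hμ 0, congrFun hμ 1, congrFun hμ 2⟩

theorem PrimePencil.exists_normalForm_onCurve {ι : Type*} [Finite ι]
    {Q₁ Q₂ : QuadraticForm ℝ (Fin 4 → ℝ)} (hQ : PrimePencil Q₁ Q₂) {c : ι → Fin 4 → ℝ} {i₀ : ι}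
    (hp : IsSmoothZero Q₁ Q₂ (c i₀)) (h₁ : ∀ i, Q₁ (c i) = 0) (h₂ : ∀ i, Q₂ (c i) = 0)
    (hc : Pairwise fun i j => LinearIndependent ℝ ![c i, c j]) :
    ∃ (N : NormalForm Q₁ Q₂) (ξ : ι → Fin 4 → ℝ), N.e ![0, 0, 0, 1] = c i₀ ∧
      (∀ i ≠ i₀, N.coeff.OnCurve (ξ i) ∧ ∃ a : ℝ, a ≠ 0 ∧ N.e (ξ i) = a • c i) ∧
      ∀ i ≠ i₀, ∀ j ≠ i₀, i ≠ j → ξ i 1 ≠ ξ j 1 := by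
  classical
  have := Fintype.ofFinite ι
  set p := c i₀
  choose μ hμ hμp hμi hμj using fun ij : ι × ι =>
    exists_dual_ne_zero_of_three p (c ij.1) (c ij.2)
  obtain ⟨o, ho₁, ho₂, ho⟩ := hQ.exists_zero_forall_ne_zero hp
    ({Q₂.polarBilin p} ∪ Finset.univ.image (fun i => tangentPlane Q₁ Q₂ p (c i))
      ∪ Finset.univ.image μ)
    (by
      simp only [Finset.mem_union, Finset.mem_singleton, Finset.mem_image, Finset.mem_univ,
        true_and, or_imp, forall_and, forall_eq, forall_exists_index, forall_apply_eq_imp_iff]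
      have hX := polarBilin_self_of_apply_eq_zero hp.zero_left
      have hZ := polarBilin_self_of_apply_eq_zero hp.zero_right
      exact ⟨⟨hZ, fun i => by simp [tangentPlane, hX, hZ]⟩, hμp⟩)
  simp only [Finset.mem_union, Finset.mem_singleton, Finset.mem_image, Finset.mem_univ, true_and,
    or_imp, forall_and, forall_eq, forall_exists_index, forall_apply_eq_imp_iff] at ho
  obtain ⟨⟨hZo, hνo⟩, hμo⟩ := ho
  obtain ⟨N, rfl, hNp⟩ := hp.exists_normalForm (by simp) ho₁ ho₂
    (hZo (hp.linearIndependent.ne_zero 1))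
  have hzero (i : ι) (hi : i ≠ i₀) : N.e.symm (c i) 0 ≠ 0 := by
    rw [← hNp] at hp hνo
    exact N.symm_zero_ne_zero hQ hp (h₁ i) (h₂ i) (hNp ▸ hc hi.symm) (hνo i)
  choose! ξ hξ a ha hξa using fun i hi =>
    N.exists_onCurve_apply_eq_smul (h₁ i) (h₂ i) (hzero i hi)
  refine ⟨N, ξ, hNp, fun i hi => ⟨hξ i hi, a i, ha i hi, hξa i hi⟩, fun i hi j hj hij => ?_⟩
  refine N.one_ne_one_of_onCurve (hξ i hi) (hξ j hj) (fun h => ha i hi ?_) (μ := μ (i, j))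
    (by rw [hNp, hμp]) (by rw [hξa i hi, map_smul, hμi, smul_zero])
    (by rw [hξa j hj, map_smul, hμj, smul_zero]) (hμo _ (hμ _))
  refine (LinearIndependent.pair_iff.1 (hc hij) (a i) (-a j) ?_).1
  rw [← hξa i hi, neg_smul, ← hξa j hj, h, add_neg_cancel]

end PointsOfNormalForm

section BaseChange

open MvPolynomial

variable {σ τ R A : Type*} [CommRing R] [CommRing A] [Algebra R A]

theorem map_algebraMap_mulVec_comp [Fintype σ] (M : Matrix τ σ R) (v : σ → R) :
    M.map (algebraMap R A) *ᵥ (algebraMap R A ∘ v) = algebraMap R A ∘ (M *ᵥ v) :=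
  funext fun i => (RingHom.map_mulVec (algebraMap R A) M v i).symm

theorem aeval_smul_of_isHomogeneous {φ : MvPolynomial σ R} {d : ℕ} (hφ : φ.IsHomogeneous d)
    (a : A) (v : σ → A) : aeval (a • v) φ = a ^ d * aeval v φ := by
  simp only [aeval_def, eval₂_eq, Finset.mul_sum]
  refine Finset.sum_congr rfl fun m hm => ?_
  have hd : ∑ i ∈ m.support, m i = d := by
    simpa [Finsupp.weight_apply, Finsupp.sum] using hφ (mem_support_iff.1 hm)
  simp only [Pi.smul_apply, smul_eq_mul, mul_pow, Finset.prod_mul_distrib,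
    Finset.prod_pow_eq_pow_sum, hd]
  ring

theorem aeval_map_mulVec_eq [IsDomain R] [Infinite R] [Fintype τ] {φ : MvPolynomial σ R}
    {ψ : MvPolynomial τ R} {M : Matrix σ τ R} (h : ∀ v, eval (M *ᵥ v) φ = eval v ψ) (ζ : τ → A) :
    aeval (M.map (algebraMap R A) *ᵥ ζ) φ = aeval ζ ψ := by
  have hψ : bind₁ (fun i => ∑ j, C (M i j) * X j) φ = ψ := MvPolynomial.funext fun v => by
    rw [← h, ← coe_aeval_eq_eval, ← coe_aeval_eq_eval, RingHom.coe_coe, RingHom.coe_coe,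
      aeval_bind₁]
    congr 2
    ext i
    simp [Matrix.mulVec, dotProduct]
  rw [← hψ, aeval_bind₁]
  congr 2
  ext i
  simp [Matrix.mulVec, dotProduct]

end BaseChange

namespace QuarticCoeff

/-- The normal form with the map `φ` applied to its coefficients. -/
def map {k k' : Type*} (φ : k → k') (q : QuarticCoeff k) : QuarticCoeff k' :=
  ⟨φ q.a, φ q.b, φ q.c, φ q.d, φ q.e, φ q.f, φ q.g, φ q.h⟩

section Map

variable {k k' : Type*} [CommRing k] [CommRing k'] (φ : k →+* k') (q : QuarticCoeff k)

theorem form₁_map (v : Fin 4 → k) : (q.map φ).form₁ (φ ∘ v) = φ (q.form₁ v) := by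
  simp [form₁_apply, map]

theorem form₂_map (v : Fin 4 → k) : (q.map φ).form₂ (φ ∘ v) = φ (q.form₂ v) := by
  simp [form₂_apply, map]

variable {q} in
theorem OnCurve.map {p : Fin 4 → k} (h : q.OnCurve p) : (q.map φ).OnCurve (φ ∘ p) where
  affine := by simp [h.affine]
  zero₁ := by rw [form₁_map, h.zero₁, map_zero]
  zero₂ := by rw [form₂_map, h.zero₂, map_zero]

theorem baseCamera_map : (baseCamera k).map φ = baseCamera k' := by
  ext i j
  fin_cases i <;> fin_cases j <;> simp [baseCamera]

theorem sourceCamera_map (p : Fin 4 → k) : (sourceCamera p).map φ = sourceCamera (φ ∘ p) := by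
  ext i j
  fin_cases i <;> fin_cases j <;> simp [sourceCamera]

theorem targetCamera_map (p : Fin 4 → k) :
    (q.targetCamera p).map φ = (q.map φ).targetCamera (φ ∘ p) := by
  ext i j
  fin_cases i <;> fin_cases j <;> simp [targetCamera, sigma, beta, map]

end Map

section Aeval

open MvPolynomial

variable {R A : Type*} [CommRing R] [CommRing A] [Algebra R A] (q : QuarticCoeff R)

theorem aeval_form₁_X (ζ : Fin 4 → A) :
    aeval ζ ((q.map C).form₁ X) = (q.map (algebraMap R A)).form₁ ζ := by
  simp [form₁_apply, map]

theorem aeval_form₂_X (ζ : Fin 4 → A) :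
    aeval ζ ((q.map C).form₂ X) = (q.map (algebraMap R A)).form₂ ζ := by
  simp [form₂_apply, map]

end Aeval

end QuarticCoeff

namespace NormalForm

open MvPolynomial QuarticCoeff

variable {K A : Type*} [Field K] [CommRing A] [Algebra K A]
  {q₁ q₂ : MvPolynomial (Fin 4) K} {Q₁ Q₂ : QuadraticForm K (Fin 4 → K)}

/-- The matrix whose columns are the coordinate vectors of a normal form. -/
noncomputable def coordMatrix (N : NormalForm Q₁ Q₂) : Matrix (Fin 4) (Fin 4) K :=
  LinearMap.toMatrix' N.e.toLinearMap

theorem coordMatrix_mulVec (N : NormalForm Q₁ Q₂) (v : Fin 4 → K) :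
    N.coordMatrix *ᵥ v = N.e v :=
  LinearMap.toMatrix'_mulVec _ v

theorem isUnit_coordMatrix (N : NormalForm Q₁ Q₂) : IsUnit N.coordMatrix :=
  Matrix.mulVec_surjective_iff_isUnit.1 fun v =>
    ⟨N.e.symm v, by rw [coordMatrix_mulVec, LinearEquiv.apply_symm_apply]⟩

theorem exists_map_coordMatrix_mulVec_eq (N : NormalForm Q₁ Q₂) (x : Fin 4 → A) :
    ∃ ζ, N.coordMatrix.map (algebraMap K A) *ᵥ ζ = x :=
  Matrix.mulVec_surjective_iff_isUnit.2
    (N.isUnit_coordMatrix.map (algebraMap K A).mapMatrix) x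

theorem form₁_map_algebraMap [Infinite K] (N : NormalForm Q₁ Q₂) (hQ₁ : ∀ v, Q₁ v = eval v q₁)
    (hQ₂ : ∀ v, Q₂ v = eval v q₂) (ζ : Fin 4 → A) :
    (N.coeff.map (algebraMap K A)).form₁ ζ =
      N.s • aeval (N.coordMatrix.map (algebraMap K A) *ᵥ ζ) q₁
        + N.t • aeval (N.coordMatrix.map (algebraMap K A) *ᵥ ζ) q₂ := by
  rw [← aeval_form₁_X, ← map_smul, ← map_smul, ← map_add]
  refine (aeval_map_mulVec_eq (fun v => ?_) ζ).symm
  have hv := QuadraticMap.congr_fun N.form₁_eq v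
  simpa [hQ₁, hQ₂, form₁_apply, QuarticCoeff.map, smul_eval, coordMatrix_mulVec] using hv.symm

theorem form₂_map_algebraMap [Infinite K] (N : NormalForm Q₁ Q₂) (hQ₂ : ∀ v, Q₂ v = eval v q₂)
    (ζ : Fin 4 → A) : (N.coeff.map (algebraMap K A)).form₂ ζ =
      N.r • aeval (N.coordMatrix.map (algebraMap K A) *ᵥ ζ) q₂ := by
  rw [← aeval_form₂_X, ← map_smul]
  refine (aeval_map_mulVec_eq (fun v => ?_) ζ).symm
  have hv := QuadraticMap.congr_fun N.form₂_eq v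
  simpa [hQ₂, form₂_apply, QuarticCoeff.map, smul_eval, coordMatrix_mulVec] using hv.symm

end NormalForm

namespace QuarticCoeff

section Family

variable {ι k : Type*} [DecidableEq ι] [Field k]

/-- The projections from `(0 : 0 : 0 : 1)` for the index `i₀` and from the points `ξ i` for the
other indices `i`. -/
def sourceFamily (i₀ : ι) (ξ : ι → Fin 4 → k) : ι → Matrix (Fin 3) (Fin 4) k :=
  Function.update (fun i => sourceCamera (ξ i)) i₀ (baseCamera k)

/-- The cameras that are conjugate to those of `sourceFamily`. -/
def targetFamily (q : QuarticCoeff k) (i₀ : ι) (ξ : ι → Fin 4 → k) :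
    ι → Matrix (Fin 3) (Fin 4) k :=
  Function.update (fun i => q.targetCamera (ξ i)) i₀ (baseCamera k)

variable {q : QuarticCoeff k} {i₀ i : ι} {ξ : ι → Fin 4 → k}

@[simp]
theorem sourceFamily_self : sourceFamily i₀ ξ i₀ = baseCamera k :=
  Function.update_self ..

theorem sourceFamily_of_ne (h : i ≠ i₀) : sourceFamily i₀ ξ i = sourceCamera (ξ i) :=
  Function.update_of_ne h ..

@[simp]
theorem targetFamily_self : q.targetFamily i₀ ξ i₀ = baseCamera k :=
  Function.update_self ..

theorem targetFamily_of_ne (h : i ≠ i₀) : q.targetFamily i₀ ξ i = q.targetCamera (ξ i) :=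
  Function.update_of_ne h ..

theorem linearIndependent_row_baseCamera : LinearIndependent k (baseCamera k).row := by
  rw [← Matrix.vecMul_injective_iff]
  intro r r' h
  ext i
  fin_cases i
  exacts [by simpa [baseCamera, Matrix.vecMul, dotProduct, Fin.sum_univ_three] using congrFun h 0,
    by simpa [baseCamera, Matrix.vecMul, dotProduct, Fin.sum_univ_three] using congrFun h 1,
    by simpa [baseCamera, Matrix.vecMul, dotProduct, Fin.sum_univ_three] using congrFun h 2]

theorem linearIndependent_row_targetFamily [NeZero (2 : k)] (hq : PrimePencil q.form₁ q.form₂)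
    (hξ : ∀ i ≠ i₀, q.OnCurve (ξ i)) (i : ι) :
    LinearIndependent k (q.targetFamily i₀ ξ i).row := by
  obtain rfl | hi := eq_or_ne i i₀
  · simpa using linearIndependent_row_baseCamera
  · simpa [targetFamily_of_ne hi] using linearIndependent_row_targetCamera hq (hξ i hi)

theorem pairwise_exists_skewRays_targetFamily [NeZero (2 : k)]
    (hq : PrimePencil q.form₁ q.form₂) (hξ : ∀ i ≠ i₀, q.OnCurve (ξ i))
    (hne : ∀ i ≠ i₀, ∀ j ≠ i₀, i ≠ j → ξ i 1 ≠ ξ j 1) :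
    Pairwise fun i j => ∃ v, SkewRays (q.targetFamily i₀ ξ i) (q.targetFamily i₀ ξ j)
      (sourceFamily i₀ ξ i *ᵥ v) (sourceFamily i₀ ξ j *ᵥ v) := by
  intro i j hij
  obtain rfl | hi := eq_or_ne i i₀
  · simpa [targetFamily_of_ne hij.symm, sourceFamily_of_ne hij.symm] using
      exists_skewRays_baseCamera hq (hξ j hij.symm)
  obtain rfl | hj := eq_or_ne j i₀
  · simpa [targetFamily_of_ne hi, sourceFamily_of_ne hi] using
      (exists_skewRays_baseCamera hq (hξ i hi)).imp fun _ => SkewRays.symm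
  · simpa [targetFamily_of_ne hi, sourceFamily_of_ne hi, targetFamily_of_ne hj,
      sourceFamily_of_ne hj] using
      exists_skewRays_targetCamera hq (hξ i hi) (hξ j hj) (hne i hi j hj hij)

theorem exists_conjugate_point_map {k' : Type*} [Field k'] (φ : k →+* k')
    (hξ : ∀ i ≠ i₀, q.OnCurve (ξ i)) {ζ : Fin 4 → k'} (h₁ : (q.map φ).form₁ ζ = 0)
    (h₂ : (q.map φ).form₂ ζ = 0) : ∃ y, y ≠ 0 ∧
      ∀ i, Parallel ((sourceFamily i₀ ξ i).map φ *ᵥ ζ) ((q.targetFamily i₀ ξ i).map φ *ᵥ y) := by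
  obtain ⟨y, hy, hbase, htarget⟩ := (q.map φ).exists_conjugate_point h₁ h₂
  refine ⟨y, hy, fun i => ?_⟩
  obtain rfl | hi := eq_or_ne i i₀
  · simpa [baseCamera_map] using hbase
  · rw [sourceFamily_of_ne hi, targetFamily_of_ne hi, sourceCamera_map, targetCamera_map]
    exact htarget _ ((hξ i hi).map φ)

theorem exists_eq_mul_baseCamera {M : Matrix (Fin 3) (Fin 4) k} (h : M *ᵥ ![0, 0, 0, 1] = 0) :
    ∃ T : Matrix (Fin 3) (Fin 3) k, M = T * baseCamera k := by
  refine ⟨Matrix.of fun i => ![M i 0, M i 1, M i 2], ?_⟩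
  ext i j
  have hi : M i 3 = 0 := by simpa [Matrix.mulVec, dotProduct, Fin.sum_univ_four] using congrFun h i
  fin_cases j <;> simp [Matrix.mul_apply, Fin.sum_univ_three, baseCamera, hi]

theorem exists_eq_mul_sourceCamera {M : Matrix (Fin 3) (Fin 4) k} {p : Fin 4 → k}
    (hp : p 0 = 1) (h : M *ᵥ p = 0) : ∃ T : Matrix (Fin 3) (Fin 3) k, M = T * sourceCamera p := by
  refine ⟨Matrix.of fun i => ![-M i 1, -M i 2, M i 3], ?_⟩
  ext i j
  have hi := congrFun h i
  simp only [Matrix.mulVec, dotProduct, Fin.sum_univ_four, hp, Pi.zero_apply, mul_one] at hi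
  have h₀ : M i 0 = -(M i 1 * p 1) + -(M i 2 * p 2) + -(M i 3 * p 3) := by linear_combination hi
  fin_cases j <;> simp [Matrix.mul_apply, Fin.sum_univ_three, sourceCamera, h₀]

end Family
end QuarticCoeff

section MatrixLemmas

variable {m m' n R : Type*} [Fintype n] [CommRing R]

theorem Parallel.mulVec {u w : n → R} (h : Parallel u w) (T : Matrix m n R) :
    Parallel (T *ᵥ u) (T *ᵥ w) := by
  intro i j
  simp only [Matrix.mulVec, dotProduct, Finset.sum_mul_sum]
  rw [Finset.sum_comm]
  exact Finset.sum_congr rfl fun a _ => Finset.sum_congr rfl fun b _ => by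
    linear_combination T i b * T j a * h b a

theorem Parallel.exists_smul {ι k : Type*} [Field k] {u w : ι → k} (h : Parallel u w)
    (hu : u ≠ 0) : ∃ c : k, w = c • u := by
  obtain ⟨i, hi⟩ := Function.ne_iff.1 hu
  refine ⟨w i / u i, funext fun j => ?_⟩
  rw [Pi.smul_apply, smul_eq_mul, div_mul_eq_mul_div, eq_div_iff hi]
  linear_combination h i j

section SkewRays

variable {N : Matrix m n R} {N' : Matrix m' n R} {x : m → R} {x' : m' → R}

theorem SkewRays.eq_zero (h : SkewRays N N' x x') {y : n → R} (hy : N *ᵥ y = 0)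
    (hy' : N' *ᵥ y = 0) : y = 0 :=
  (h y 0 0 (by rw [hy, zero_smul]) (by rw [hy', zero_smul])).1

theorem SkewRays.mul_left [Fintype m] [DecidableEq m] [Fintype m'] [DecidableEq m']
    (h : SkewRays N N' x x') {T : Matrix m m R} {T' : Matrix m' m' R} (hT : IsUnit T)
    (hT' : IsUnit T') : SkewRays (T * N) (T' * N') (T *ᵥ x) (T' *ᵥ x') := by
  intro y s t hs ht
  rw [← Matrix.mulVec_mulVec, ← Matrix.mulVec_smul] at hs ht
  exact h y s t (Matrix.mulVec_injective_of_isUnit hT hs)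
    (Matrix.mulVec_injective_of_isUnit hT' ht)

end SkewRays

theorem isUnit_left_of_rank_mul_eq {m k : Type*} [Fintype m] [Field k] {d : ℕ}
    {T : Matrix (Fin d) (Fin d) k} {N : Matrix (Fin d) m k} (h : (T * N).rank = d) : IsUnit T := by
  have hT : T.rank = d := T.rank_le_height.antisymm (h.ge.trans (T.rank_mul_le_left N))
  rw [← Matrix.linearIndependent_rows_iff_isUnit, linearIndependent_iff_card_eq_finrank_span,
    Set.finrank, ← Matrix.rank_eq_finrank_span_row, hT, Fintype.card_fin]

end MatrixLemmas

namespace Camera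

theorem matC_mulVec (P : Camera) (v : Fin 4 → ℝ) :
    P.matC *ᵥ (algebraMap ℝ ℂ ∘ v) = algebraMap ℝ ℂ ∘ (P.mat *ᵥ v) :=
  map_algebraMap_mulVec_comp ..

theorem exists_ne_zero_mulVec_eq_zero (P : Camera) : ∃ c : Fin 4 → ℝ, c ≠ 0 ∧ P.mat *ᵥ c = 0 := by
  obtain ⟨c, hc, hc0⟩ := Submodule.exists_mem_ne_zero_of_ne_bot
    (LinearMap.ker_ne_bot_of_finrank_lt (f := P.mat.mulVecLin) (by simp))
  exact ⟨c, hc0, hc⟩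

variable {P P' : Camera} {c : Fin 4 → ℝ}

theorem algebraMap_comp_ne_zero (hc : c ≠ 0) : algebraMap ℝ ℂ ∘ c ≠ 0 := fun h =>
  hc <| funext fun i => Complex.ofReal_eq_zero.1 (congrFun h i)

theorem center_eq_mk (hc : c ≠ 0) (h : P.mat *ᵥ c = 0) :
    P.center = .mk ℂ (algebraMap ℝ ℂ ∘ c) (algebraMap_comp_ne_zero hc) := by
  apply Projectivization.submodule_injective
  rw [center, Projectivization.submodule_mk'', Projectivization.submodule_mk]
  refine (Submodule.eq_of_le_of_finrank_eq ?_ ?_).symm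
  · rw [Submodule.span_singleton_le_iff_mem, LinearMap.mem_ker, Matrix.mulVecLin_apply,
      P.matC_mulVec, h]
    ext
    simp
  · rw [P.finrank_ker, finrank_span_singleton (algebraMap_comp_ne_zero hc)]

theorem exists_center_rep_eq_smul (hc : c ≠ 0) (h : P.mat *ᵥ c = 0) :
    ∃ a : ℂ, a ≠ 0 ∧ P.center.rep = a • (algebraMap ℝ ℂ ∘ c) := by
  rw [center_eq_mk hc h]
  obtain ⟨a, ha⟩ := Projectivization.exists_smul_eq_mk_rep ℂ _ (algebraMap_comp_ne_zero hc)
  exact ⟨a, a.ne_zero, ha.symm⟩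

theorem center_eq_center_iff (hc : c ≠ 0) (h : P.mat *ᵥ c = 0) :
    P.center = P'.center ↔ P'.mat *ᵥ c = 0 := by
  refine ⟨fun heq => ?_, fun h' => by rw [center_eq_mk hc h, center_eq_mk hc h']⟩
  obtain ⟨c', hc', h'⟩ := P'.exists_ne_zero_mulVec_eq_zero
  rw [center_eq_mk hc h, center_eq_mk hc' h', Projectivization.mk_eq_mk_iff'] at heq
  obtain ⟨a, ha⟩ := heq
  have hC : P'.matC *ᵥ (algebraMap ℝ ℂ ∘ c) = 0 := by
    rw [← ha, Matrix.mulVec_smul, matC_mulVec, h']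
    ext
    simp
  rw [matC_mulVec] at hC
  exact funext fun i => Complex.ofReal_eq_zero.1 (congrFun hC i)

theorem center_ne_center_of_skewRays {x x' : Fin 3 → ℝ} (h : SkewRays P.mat P'.mat x x') :
    P.center ≠ P'.center := by
  obtain ⟨c, hc, hP⟩ := P.exists_ne_zero_mulVec_eq_zero
  exact fun heq => hc (h.eq_zero hP ((center_eq_center_iff hc hP).1 heq))

theorem linearIndependent_of_center_ne {c' : Fin 4 → ℝ} (hc : c ≠ 0) (h : P.mat *ᵥ c = 0)
    (hc' : c' ≠ 0) (h' : P'.mat *ᵥ c' = 0) (hne : P.center ≠ P'.center) :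
    LinearIndependent ℝ ![c, c'] := by
  refine (LinearIndependent.pair_iff' hc).2 fun a ha => hne.symm ?_
  rw [center_eq_center_iff hc' h', ← ha, Matrix.mulVec_smul, h, smul_zero]

/-- Vectors indexed by the columns of `pairMatrix`, split into the blocks of sizes `4` and `2`. -/
noncomputable def pairDomain : ((Fin 4 → ℝ) × (Fin 2 → ℝ)) ≃ₗ[ℝ] (Fin 6 → ℝ) :=
  (LinearEquiv.sumArrowLequivProdArrow (Fin 4) (Fin 2) ℝ ℝ).symm ≪≫ₗ
    LinearEquiv.funCongrLeft ℝ ℝ (finSumFinEquiv : Fin 4 ⊕ Fin 2 ≃ Fin 6).symm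

/-- Vectors indexed by the rows of `pairMatrix`, split into the blocks of sizes `3` and `3`. -/
noncomputable def pairCodomain : ((Fin 3 → ℝ) × (Fin 3 → ℝ)) ≃ₗ[ℝ] (Fin 6 → ℝ) :=
  (LinearEquiv.sumArrowLequivProdArrow (Fin 3) (Fin 3) ℝ ℝ).symm ≪≫ₗ
    LinearEquiv.funCongrLeft ℝ ℝ (finSumFinEquiv : Fin 3 ⊕ Fin 3 ≃ Fin 6).symm

variable {Q Q' : Camera} {x y : Fin 3 → ℝ}

variable (P P') in
theorem pairMatrix_mulVec (x y : Fin 3 → ℝ) (v : Fin 4 → ℝ) (w : Fin 2 → ℝ) :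
    pairMatrix P P' x y *ᵥ pairDomain (v, w) =
      pairCodomain (P.mat *ᵥ v + w 0 • x, P'.mat *ᵥ v + w 1 • y) := by
  change pairMatrix P P' x y *ᵥ (Sum.elim v w ∘ (finSumFinEquiv : Fin 4 ⊕ Fin 2 ≃ Fin 6).symm) =
    Sum.elim (P.mat *ᵥ v + w 0 • x) (P'.mat *ᵥ v + w 1 • y) ∘
      (finSumFinEquiv : Fin 3 ⊕ Fin 3 ≃ Fin 6).symm
  rw [pairMatrix, Matrix.reindex_apply, Matrix.submatrix_mulVec_equiv, Equiv.symm_symm,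
    Function.comp_assoc, Equiv.symm_comp_self, Function.comp_id, Matrix.fromBlocks_mulVec,
    Sum.elim_comp_inl, Sum.elim_comp_inr]
  congr 3 <;> · ext i; simp [Matrix.mulVec, dotProduct, mul_comm]

theorem det_pairMatrix_ne_zero_iff :
    (pairMatrix P P' x y).det ≠ 0 ↔ SkewRays P.mat P'.mat x y := by
  rw [Ne, ← Matrix.exists_mulVec_eq_zero_iff]
  push Not
  constructor
  · intro h v s t hs ht
    by_contra hne
    refine h (pairDomain (v, ![-s, -t])) (fun h0 => hne ?_) ?_
    · simpa using h0
    · simp [pairMatrix_mulVec, hs, ht]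
  · intro h z hz h0
    obtain ⟨⟨v, w⟩, rfl⟩ := pairDomain.surjective z
    rw [pairMatrix_mulVec, LinearEquiv.map_eq_zero_iff, Prod.mk_eq_zero,
      ← eq_neg_iff_add_eq_zero, ← eq_neg_iff_add_eq_zero, ← neg_smul, ← neg_smul] at h0
    obtain ⟨hv, hs, ht⟩ := h v (-w 0) (-w 1) h0.1 h0.2
    rw [neg_eq_zero] at hs ht
    have hw : w = 0 := by
      ext i
      fin_cases i
      exacts [hs, ht]
    rw [hv, hw, Prod.mk_zero_zero, map_zero] at hz
    exact hz rfl

variable (P P')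

theorem det_pairMatrix_eq_cramer_left (x y : Fin 3 → ℝ) :
    (pairMatrix P P' x y).det = (pairMatrix P P' 0 y).cramer (pairCodomain (x, 0)) 4 := by
  rw [Matrix.cramer_apply]
  congr 1
  ext i j
  obtain ⟨i, rfl⟩ := (finSumFinEquiv : Fin 3 ⊕ Fin 3 ≃ Fin 6).surjective i
  rcases i with i | i <;> fin_cases i <;> fin_cases j <;> rfl

theorem det_pairMatrix_eq_cramer_right (x y : Fin 3 → ℝ) :
    (pairMatrix P P' x y).det = (pairMatrix P P' x 0).cramer (pairCodomain (0, y)) 5 := by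
  rw [Matrix.cramer_apply]
  congr 1
  ext i j
  obtain ⟨i, rfl⟩ := (finSumFinEquiv : Fin 3 ⊕ Fin 3 ≃ Fin 6).surjective i
  rcases i with i | i <;> fin_cases i <;> fin_cases j <;> rfl

/-- The bilinear form whose Gram matrix is the fundamental matrix. -/
noncomputable def pairForm : (Fin 3 → ℝ) →ₗ[ℝ] (Fin 3 → ℝ) →ₗ[ℝ] ℝ :=
  .mk₂ ℝ (fun x y => (pairMatrix P P' x y).det)
    (fun x x' y => by
      rw [det_pairMatrix_eq_cramer_left, ← add_zero (0 : Fin 3 → ℝ), ← Prod.mk_add_mk, map_add,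
        map_add, Pi.add_apply, add_zero, ← det_pairMatrix_eq_cramer_left,
        ← det_pairMatrix_eq_cramer_left])
    (fun a x y => by
      rw [det_pairMatrix_eq_cramer_left, ← smul_zero (A := Fin 3 → ℝ) a, ← Prod.smul_mk, map_smul,
        map_smul, Pi.smul_apply, smul_zero, ← det_pairMatrix_eq_cramer_left])
    (fun x y y' => by
      rw [det_pairMatrix_eq_cramer_right, ← add_zero (0 : Fin 3 → ℝ), ← Prod.mk_add_mk, map_add,
        map_add, Pi.add_apply, add_zero, ← det_pairMatrix_eq_cramer_right,
        ← det_pairMatrix_eq_cramer_right])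
    (fun a x y => by
      rw [det_pairMatrix_eq_cramer_right, ← smul_zero (A := Fin 3 → ℝ) a, ← Prod.smul_mk, map_smul,
        map_smul, Pi.smul_apply, smul_zero, ← det_pairMatrix_eq_cramer_right])

theorem toMatrix₂'_pairForm :
    LinearMap.toMatrix₂' ℝ (pairForm P P') = P.fundamentalMatrix P' :=
  Matrix.ext fun a b => by
    rw [LinearMap.toMatrix₂'_apply, pairForm, LinearMap.mk₂_apply, fundamentalMatrix,
      Matrix.of_apply]

theorem det_pairMatrix_eq_dotProduct (x y : Fin 3 → ℝ) :
    (pairMatrix P P' x y).det = x ⬝ᵥ P.fundamentalMatrix P' *ᵥ y := by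
  rw [← toMatrix₂'_pairForm, ← Matrix.toLinearMap₂'_apply', Matrix.toLinearMap₂'_toMatrix',
    pairForm, LinearMap.mk₂_apply]

variable {P P'}

theorem fundamentalMatrix_ne_smul {v : Fin 4 → ℝ}
    (h : SkewRays Q.mat Q'.mat (P.mat *ᵥ v) (P'.mat *ᵥ v)) (c : ℝ) :
    Q.fundamentalMatrix Q' ≠ c • P.fundamentalMatrix P' := by
  have hP : ¬ SkewRays P.mat P'.mat (P.mat *ᵥ v) (P'.mat *ᵥ v) := fun hskew =>
    one_ne_zero (hskew v 1 1 (one_smul ..).symm (one_smul ..).symm).2.1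
  rw [← det_pairMatrix_ne_zero_iff, det_pairMatrix_eq_dotProduct] at h hP
  intro hF
  apply h
  rw [hF, Matrix.smul_mulVec, dotProduct_smul, not_ne_iff.1 hP, smul_zero]

end Camera

section Complexification

variable {m m' n : Type*} [Fintype n]

theorem re_comp_mulVec (M : Matrix m n ℝ) (w : n → ℂ) :
    Complex.re ∘ (M.map (algebraMap ℝ ℂ) *ᵥ w) = M *ᵥ (Complex.re ∘ w) := by
  ext i
  simp [Matrix.mulVec, dotProduct]

theorem im_comp_mulVec (M : Matrix m n ℝ) (w : n → ℂ) :
    Complex.im ∘ (M.map (algebraMap ℝ ℂ) *ᵥ w) = M *ᵥ (Complex.im ∘ w) := by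
  ext i
  simp [Matrix.mulVec, dotProduct]

theorem SkewRays.complexification {N : Matrix m n ℝ} {N' : Matrix m' n ℝ} {x : m → ℝ}
    {x' : m' → ℝ} (h : SkewRays N N' x x') :
    SkewRays (N.map (algebraMap ℝ ℂ)) (N'.map (algebraMap ℝ ℂ)) (algebraMap ℝ ℂ ∘ x)
      (algebraMap ℝ ℂ ∘ x') := by
  intro w s t hs ht
  have hre := h (Complex.re ∘ w) s.re t.re
    (by rw [← re_comp_mulVec, hs]; ext; simp) (by rw [← re_comp_mulVec, ht]; ext; simp)
  have him := h (Complex.im ∘ w) s.im t.im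
    (by rw [← im_comp_mulVec, hs]; ext; simp) (by rw [← im_comp_mulVec, ht]; ext; simp)
  exact ⟨funext fun i => Complex.ext (congrFun hre.1 i) (congrFun him.1 i),
    Complex.ext hre.2.1 him.2.1, Complex.ext hre.2.2 him.2.2⟩

end Complexification

theorem exists_imagePlane_rep_smul {u w : Fin 3 → ℂ} (h : Parallel u w) :
    ∃ (s : ImagePlane) (c c' : ℂ), u = c • s.rep ∧ w = c' • s.rep := by
  obtain ⟨z, hz, a, b, rfl, rfl⟩ : ∃ z : Fin 3 → ℂ, z ≠ 0 ∧ ∃ a b : ℂ, u = a • z ∧ w = b • z := by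
    by_cases hu : u = 0
    · by_cases hw : w = 0
      · exact ⟨1, one_ne_zero, 0, 0, by simp [hu], by simp [hw]⟩
      · exact ⟨w, hw, 0, 1, by simp [hu], (one_smul ..).symm⟩
    · obtain ⟨b, rfl⟩ := h.exists_smul hu
      exact ⟨u, hu, 1, b, (one_smul ..).symm, rfl⟩
  obtain ⟨r, hr⟩ := (Projectivization.mk_eq_mk_iff' ℂ z _ hz (Projectivization.rep_nonzero _)).1
    (Projectivization.mk_rep (.mk ℂ z hz)).symm
  exact ⟨.mk ℂ z hz, a * r, b * r, by rw [mul_smul, hr], by rw [mul_smul, hr]⟩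

theorem Camera.isImage_mk {P : Camera} {y : Fin 4 → ℂ} (hy : y ≠ 0) {s : ImagePlane} {c : ℂ}
    (h : P.matC *ᵥ y = c • s.rep) : P.IsImage (.mk ℂ y hy) s := by
  obtain ⟨a, ha⟩ := Projectivization.exists_smul_eq_mk_rep ℂ y hy
  exact ⟨a * c, by rw [← ha, Units.smul_def, Matrix.mulVec_smul, h, mul_smul]⟩

/-- The cameras `Q i` are conjugate to the cameras `P i` along `C`: every point of `C` has the same
images under the `P i` as some point under the `Q i`, while for each pair of views some point has
images under the `P i` whose viewing rays under the `Q i` are skew. -/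
structure AreConjugateAlong {ι : Type*} (P Q : ι → Camera) (C : Set Space) : Prop where
  pairwise_exists_skewRays : Pairwise fun i j => ∃ v : Fin 4 → ℝ,
    SkewRays (Q i).mat (Q j).mat ((P i).mat *ᵥ v) ((P j).mat *ᵥ v)
  exists_parallel : ∀ x ∈ C, ∃ y : Fin 4 → ℂ, y ≠ 0 ∧
    ∀ i, Parallel ((P i).matC *ᵥ x.rep) ((Q i).matC *ᵥ y)

theorem AreConjugateAlong.exists_isImage {ι : Type*} {P Q : ι → Camera} {C : Set Space}
    (h : AreConjugateAlong P Q C) {x : Space} (hx : x ∈ C) :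
    ∃ (y : Space) (s : ι → ImagePlane), (∀ i, (P i).IsImage x (s i)) ∧
      ∀ i, (Q i).IsImage y (s i) := by
  obtain ⟨y, hy, hpar⟩ := h.exists_parallel x hx
  choose s c c' hc hc' using fun i => exists_imagePlane_rep_smul (hpar i)
  exact ⟨.mk ℂ y hy, s, fun i => ⟨c i, hc i⟩, fun i => Camera.isImage_mk hy (hc' i)⟩

namespace Configuration

variable {n : ℕ} {K L : Configuration n}

theorem not_equivalent_of_skewRays {i j : Fin n} {v : Fin 4 → ℝ}
    (h : SkewRays (L.camera i).mat (L.camera j).mat ((K.camera i).mat *ᵥ v)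
      ((K.camera j).mat *ᵥ v)) : ¬ K.Equivalent L := by
  rintro ⟨H, -, hH⟩
  have hmul (l : Fin n) : ∃ b : ℂ, b ≠ 0 ∧ (L.camera l).matC *ᵥ (H.val *ᵥ (algebraMap ℝ ℂ ∘ v)) =
      b • (algebraMap ℝ ℂ ∘ ((K.camera l).mat *ᵥ v)) := by
    obtain ⟨c, hc, hl⟩ := hH l
    refine ⟨c⁻¹, inv_ne_zero hc, ?_⟩
    rw [eq_inv_smul_iff₀ hc, ← Matrix.smul_mulVec, ← hl, Matrix.mulVec_mulVec, Matrix.mul_assoc,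
      ← Units.val_mul, inv_mul_cancel, Units.val_one, Matrix.mul_one, Camera.matC_mulVec]
  obtain ⟨b, hb, hi⟩ := hmul i
  obtain ⟨b', -, hj⟩ := hmul j
  exact hb (h.complexification _ b b' hi hj).2.1

theorem isNontrivialCritical_of_areConjugateAlong (hn : 2 ≤ n) {Q : Fin n → Camera} {C : Set Space}
    (h : AreConjugateAlong K.camera Q C) (hK : K.points ⊆ C) : K.IsNontrivialCritical := by
  have hinj : Function.Injective fun i => (Q i).center := by
    intro i j hij
    by_contra hne
    obtain ⟨v, hv⟩ := h.pairwise_exists_skewRays hne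
    exact Camera.center_ne_center_of_skewRays hv hij
  let IsImageQ (y : Space) (s : Fin n → ImagePlane) : Prop := ∀ i, (Q i).IsImage y (s i)
  let L : Configuration n := ⟨Q, hinj, {y | ∃ x ∈ K.points, ∃ s, K.IsImage x s ∧ IsImageQ y s}⟩
  refine ⟨L, ⟨⟨{s | ∃ x ∈ K.points, ∃ y, K.IsImage x s ∧ IsImageQ y s}, ⟨?_, ?_⟩, ?_, ?_⟩, ?_⟩, ?_⟩
  · rintro s ⟨x, hx, y, hs, -⟩
    exact ⟨x, hx, hs⟩
  · intro x hx
    obtain ⟨y, s, hs, hs'⟩ := h.exists_isImage (hK hx)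
    exact ⟨s, ⟨x, hx, y, hs, hs'⟩, hs⟩
  · rintro s ⟨x, hx, y, hs, hs'⟩
    exact ⟨y, ⟨x, hx, s, hs, hs'⟩, hs'⟩
  · rintro y ⟨x, hx, s, hs, hs'⟩
    exact ⟨s, ⟨x, hx, y, hs, hs'⟩, hs'⟩
  · obtain ⟨v, hv⟩ := h.pairwise_exists_skewRays
      (show (⟨0, by omega⟩ : Fin n) ≠ ⟨1, by omega⟩ by simp)
    exact not_equivalent_of_skewRays hv
  · rintro i j hij ⟨c, -, hF⟩
    obtain ⟨v, hv⟩ := h.pairwise_exists_skewRays hij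
    exact Camera.fundamentalMatrix_ne_smul hv c hF

end Configuration

section RealCenters

open MvPolynomial

theorem aeval_smul_algebraMap_comp {σ R A : Type*} [CommRing R] [CommRing A] [Algebra R A]
    {φ : MvPolynomial σ R} {d : ℕ} (hφ : φ.IsHomogeneous d) (a : A) (c : σ → R) :
    aeval (a • (algebraMap R A ∘ c)) φ = a ^ d * algebraMap R A (eval c φ) := by
  rw [aeval_smul_of_isHomogeneous hφ, aeval_algebraMap_apply, aeval_eq_eval]

variable {q₁ q₂ : MvPolynomial (Fin 4) ℝ} {x : Space} {a : ℂ} {c : Fin 4 → ℝ}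

theorem mem_quarticCurve_iff_eval (hC : IsIrreducibleQuartic q₁ q₂) (ha : a ≠ 0)
    (hx : x.rep = a • (algebraMap ℝ ℂ ∘ c)) :
    x ∈ quarticCurve q₁ q₂ ↔ eval c q₁ = 0 ∧ eval c q₂ = 0 := by
  rw [quarticCurve, Set.mem_ofPred_eq, hx, aeval_smul_algebraMap_comp hC.homogeneous_left,
    aeval_smul_algebraMap_comp hC.homogeneous_right]
  simp [ha]

theorem gradient_eq_smul {q : MvPolynomial (Fin 4) ℝ} (hq : q.IsHomogeneous 2)
    (hx : x.rep = a • (algebraMap ℝ ℂ ∘ c)) :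
    gradient q x = a • (algebraMap ℝ ℂ ∘ fun i => eval c (pderiv i q)) := by
  ext i
  rw [gradient, hx, aeval_smul_algebraMap_comp hq.pderiv]
  simp

theorem linearIndependent_eval_pderiv (hC : IsIrreducibleQuartic q₁ q₂)
    (hx : x.rep = a • (algebraMap ℝ ℂ ∘ c)) (hmem : x ∈ quarticCurve q₁ q₂)
    (hsmooth : ¬ IsSingularPoint q₁ q₂ x) :
    LinearIndependent ℝ ![fun i => eval c (pderiv i q₁), fun i => eval c (pderiv i q₂)] := by
  have hgrad : LinearIndependent ℂ ![gradient q₁ x, gradient q₂ x] :=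
    by_contra fun h => hsmooth ⟨hmem, h⟩
  rw [gradient_eq_smul hC.homogeneous_left hx, gradient_eq_smul hC.homogeneous_right hx] at hgrad
  refine LinearIndependent.pair_iff.2 fun α β h => ?_
  have hαβ := LinearIndependent.pair_iff.1 hgrad α β <| funext fun i => by
    have hi := congrArg (algebraMap ℝ ℂ) (congrFun h i)
    simp only [Pi.add_apply, Pi.smul_apply, smul_eq_mul, map_add, map_mul, Pi.zero_apply, map_zero,
      Complex.coe_algebraMap, Function.comp_apply] at hi ⊢
    linear_combination a * hi
  exact_mod_cast hαβ

end RealCenters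

section Assembly

variable {ι : Type*} {q₁ q₂ : MvPolynomial (Fin 4) ℝ} {Q₁ Q₂ : QuadraticForm ℝ (Fin 4 → ℝ)}
  {i₀ : ι} {P : ι → Camera}

open QuarticCoeff

theorem exists_normalForm_of_centers [Finite ι] (hC : IsIrreducibleQuartic q₁ q₂)
    (hQ₁ : ∀ v, Q₁ v = MvPolynomial.eval v q₁) (hQ₂ : ∀ v, Q₂ v = MvPolynomial.eval v q₂)
    (hinj : Function.Injective fun i => (P i).center)
    (hcenter : ∀ i, (P i).center ∈ quarticCurve q₁ q₂)
    (hsmooth : ¬ IsSingularPoint q₁ q₂ (P i₀).center) :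
    ∃ (N : NormalForm Q₁ Q₂) (ξ : ι → Fin 4 → ℝ),
      (P i₀).mat *ᵥ N.e ![0, 0, 0, 1] = 0 ∧
      (∀ i ≠ i₀, N.coeff.OnCurve (ξ i) ∧ (P i).mat *ᵥ N.e (ξ i) = 0) ∧
      ∀ i ≠ i₀, ∀ j ≠ i₀, i ≠ j → ξ i 1 ≠ ξ j 1 := by
  choose c hc hPc using fun i => (P i).exists_ne_zero_mulVec_eq_zero
  choose a ha hrep using fun i => Camera.exists_center_rep_eq_smul (hc i) (hPc i)
  have heval i := (mem_quarticCurve_iff_eval hC (ha i) (hrep i)).1 (hcenter i)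
  have hp : IsSmoothZero Q₁ Q₂ (c i₀) :=
    isSmoothZero_of_linearIndependent_pderiv hC.homogeneous_left hC.homogeneous_right hQ₁ hQ₂
      (heval i₀).1 (heval i₀).2
      (linearIndependent_eval_pderiv hC (hrep i₀) (hcenter i₀) hsmooth)
  obtain ⟨N, ξ, hbase, hξ, hne⟩ := (hC.primePencil hQ₁ hQ₂).exists_normalForm_onCurve hp
    (fun i => (hQ₁ _).trans (heval i).1) (fun i => (hQ₂ _).trans (heval i).2) fun i j hij =>
      Camera.linearIndependent_of_center_ne (hc i) (hPc i) (hc j) (hPc j) (hinj.ne hij)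
  refine ⟨N, ξ, by rw [hbase, hPc], fun i hi => ?_, hne⟩
  obtain ⟨hcurve, b, -, hb⟩ := hξ i hi
  exact ⟨hcurve, by rw [hb, Matrix.mulVec_smul, hPc, smul_zero]⟩

theorem exists_isUnit_mul_sourceFamily [DecidableEq ι] (N : NormalForm Q₁ Q₂)
    {ξ : ι → Fin 4 → ℝ} (hbase : (P i₀).mat *ᵥ N.e ![0, 0, 0, 1] = 0)
    (hξ : ∀ i ≠ i₀, N.coeff.OnCurve (ξ i) ∧ (P i).mat *ᵥ N.e (ξ i) = 0) (i : ι) :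
    ∃ T : Matrix (Fin 3) (Fin 3) ℝ, IsUnit T ∧
      (P i).mat * N.coordMatrix = T * sourceFamily i₀ ξ i := by
  obtain ⟨T, hT⟩ : ∃ T : Matrix (Fin 3) (Fin 3) ℝ,
      (P i).mat * N.coordMatrix = T * sourceFamily i₀ ξ i := by
    obtain rfl | hi := eq_or_ne i i₀
    · rw [sourceFamily_self]
      exact exists_eq_mul_baseCamera
        (by rw [← Matrix.mulVec_mulVec, N.coordMatrix_mulVec, hbase])
    · rw [sourceFamily_of_ne hi]
      exact exists_eq_mul_sourceCamera (hξ i hi).1.affine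
        (by rw [← Matrix.mulVec_mulVec, N.coordMatrix_mulVec, (hξ i hi).2])
  refine ⟨T, isUnit_left_of_rank_mul_eq (N := sourceFamily i₀ ξ i) ?_, hT⟩
  rw [← hT, Matrix.rank_mul_eq_left_of_isUnit_det _ _
    ((Matrix.isUnit_iff_isUnit_det _).1 N.isUnit_coordMatrix), (P i).full_rank]

theorem areConjugateAlong_quarticCurve [DecidableEq ι] (hC : IsIrreducibleQuartic q₁ q₂)
    (hQ₁ : ∀ v, Q₁ v = MvPolynomial.eval v q₁) (hQ₂ : ∀ v, Q₂ v = MvPolynomial.eval v q₂)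
    (N : NormalForm Q₁ Q₂) {ξ : ι → Fin 4 → ℝ} (hξ : ∀ i ≠ i₀, N.coeff.OnCurve (ξ i))
    (hne : ∀ i ≠ i₀, ∀ j ≠ i₀, i ≠ j → ξ i 1 ≠ ξ j 1) {T : ι → Matrix (Fin 3) (Fin 3) ℝ}
    (hT : ∀ i, IsUnit (T i)) (hP : ∀ i, (P i).mat * N.coordMatrix = T i * sourceFamily i₀ ξ i)
    {Q : ι → Camera} (hQ : ∀ i, (Q i).mat = T i * N.coeff.targetFamily i₀ ξ i) :
    AreConjugateAlong P Q (quarticCurve q₁ q₂) where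
  pairwise_exists_skewRays i j hij := by
    obtain ⟨v, hv⟩ := pairwise_exists_skewRays_targetFamily
      (N.primePencil (hC.primePencil hQ₁ hQ₂)) hξ hne hij
    refine ⟨N.coordMatrix *ᵥ v, ?_⟩
    rw [hQ, hQ, Matrix.mulVec_mulVec, Matrix.mulVec_mulVec, hP, hP, ← Matrix.mulVec_mulVec,
      ← Matrix.mulVec_mulVec]
    exact hv.mul_left (hT i) (hT j)
  exists_parallel x hx := by
    obtain ⟨ζ, hζ⟩ := N.exists_map_coordMatrix_mulVec_eq x.rep
    obtain ⟨y, hy, hpar⟩ := exists_conjugate_point_map (algebraMap ℝ ℂ) hξ (ζ := ζ)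
      (by rw [N.form₁_map_algebraMap hQ₁ hQ₂, hζ, hx.1, hx.2, smul_zero, smul_zero, add_zero])
      (by rw [N.form₂_map_algebraMap hQ₂, hζ, hx.2, smul_zero])
    refine ⟨y, hy, fun i => ?_⟩
    rw [← hζ, Matrix.mulVec_mulVec, Camera.matC, Camera.matC, ← Matrix.map_mul, hP, hQ,
      Matrix.map_mul, Matrix.map_mul, ← Matrix.mulVec_mulVec, ← Matrix.mulVec_mulVec]
    exact (hpar i).mulVec _

theorem exists_areConjugateAlong_quarticCurve [Finite ι] (hC : IsIrreducibleQuartic q₁ q₂)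
    (hinj : Function.Injective fun i => (P i).center)
    (hcenter : ∀ i, (P i).center ∈ quarticCurve q₁ q₂)
    (hsmooth : ¬ IsSingularPoint q₁ q₂ (P i₀).center) :
    ∃ Q : ι → Camera, AreConjugateAlong P Q (quarticCurve q₁ q₂) := by
  classical
  obtain ⟨Q₁, hQ₁⟩ := exists_quadraticForm_apply_eq_eval hC.homogeneous_left
  obtain ⟨Q₂, hQ₂⟩ := exists_quadraticForm_apply_eq_eval hC.homogeneous_right
  obtain ⟨N, ξ, hbase, hξ, hne⟩ := exists_normalForm_of_centers hC hQ₁ hQ₂ hinj hcenter hsmooth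
  choose T hT hP using exists_isUnit_mul_sourceFamily N hbase hξ
  have hrank (i : ι) : (T i * N.coeff.targetFamily i₀ ξ i).rank = 3 := by
    rw [Matrix.rank_mul_eq_right_of_isUnit_det _ _ ((Matrix.isUnit_iff_isUnit_det _).1 (hT i)),
      (linearIndependent_row_targetFamily (N.primePencil (hC.primePencil hQ₁ hQ₂))
        (fun j hj => (hξ j hj).1) i).rank_matrix, Fintype.card_fin]
  exact ⟨fun i => ⟨_, hrank i⟩, areConjugateAlong_quarticCurve hC hQ₁ hQ₂ N
    (fun i hi => (hξ i hi).1) hne hT hP fun _ => rfl⟩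

end Assembly

end Vision

theorem mainTheorem4_general (q₁ q₂ : MvPolynomial (Fin 4) ℝ)
    (hC : Vision.IsIrreducibleQuartic q₁ q₂) (n : ℕ) (hn : 2 ≤ n) (K : Vision.Configuration n)
    (hcenter : ∀ i, (K.camera i).center ∈ Vision.quarticCurve q₁ q₂)
    (hsmooth : ∃ i, ¬ Vision.IsSingularPoint q₁ q₂ (K.camera i).center)
    (hpoints : K.points ⊆ Vision.quarticCurve q₁ q₂) :
    K.IsNontrivialCritical := by
  obtain ⟨i₀, hi₀⟩ := hsmooth
  obtain ⟨Q, hQ⟩ :=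
    Vision.exists_areConjugateAlong_quarticCurve hC K.center_injective hcenter hi₀
  exact Vision.Configuration.isNontrivialCritical_of_areConjugateAlong hn hQ hpoints

theorem mainTheorem4 (q₁ q₂ : MvPolynomial (Fin 4) ℝ) (hC : Vision.IsIrreducibleQuartic q₁ q₂)
    (n : ℕ) (hn : 2 ≤ n) (K : Vision.Configuration n)
    (hcenter : ∀ i, (K.camera i).center ∈ Vision.quarticCurve q₁ q₂)
    (hsmooth : ∀ i, ¬ Vision.IsSingularPoint q₁ q₂ (K.camera i).center)
    (hpoints : K.points ⊆ Vision.quarticCurve q₁ q₂) :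
    K.IsNontrivialCritical :=
  mainTheorem4_general q₁ q₂ hC n hn K hcenter ⟨⟨0, by omega⟩, hsmooth _⟩ hpoints
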